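/- Setting. Let $\Sigma, M, \mathcal H$ be real Hilbert spaces with $M\subseteq\mathcal H\subseteq M^\star$ (continuous dense embedding), and let $a:\Sigma\times\Sigma\to\mathbb R$ and $b:\Sigma\times M\to\mathbb R$ be continuous bilinear forms such that $a$ is symmetric, positive definite and elliptic on the kernel of $b$, and $b$ satisfies the inf-sup condition. Write $|\tau|_a=a(\tau,\tau)^{1/2}$. For $g\in\mathcal H$ let $(Ag,Tg)\in\Sigma\times M$ be the solution of $$a(Ag,\tau)+b(\tau,Tg)=0\ \ \forall\tau\in\Sigma,\qquad b(Ag,v)=-(g,v)_{\mathcal H}\ \ \forall v\in M,$$ and assume that $T:\mathcal H\to\mathcal H$ is compact. Let $0<\lambda_1\le\lambda_2\le\cdots$ be all eigenvalues of the problem $a(\sigma,\tau)+b(\tau,u)=0$ $\forall\tau\in\Sigma$, $b(\sigma,v)=-\lambda(u,v)_{\mathcal H}$ $\forall v\in M$, repeated according to multiplicity, with $\mathcal H$-orthonormal eigenfunctions $u_1,u_2,\dots$. Fix $J=\{n+1,\dots,n+N\}$ and let $W=\operatorname{span}\{u_j: j\in J\}$. A discretization with constant $\rho$ is a pair of finite-dimensional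 subspaces $\Sigma_\ell\subset\Sigma$, $M_\ell\subset M$ such that (a) the functionals $b(\tau,\cdot)$, $\tau\in\Sigma_\ell$, are exactly the functionals $(w,\cdot)_{\mathcal H}$, $w\in M_\ell$, on $M$ (for the mixed Laplacian: $\operatorname{div}\Sigma_\ell=M_\ell$); (b) for every $g\in\mathcal H$ there is $\sigma_\ell\in\Sigma_\ell$ with $b(Ag-\sigma_\ell,v)=0$ for all $v\in M_\ell$ and $|Ag-\sigma_\ell|_a\le\rho\|g\|_{\mathcal H}$; (c) $\inf_{v\in M_\ell}\|Tg-v\|_{\mathcal H}\le\rho\|g\|_{\mathcal H}$ for every $g\in\mathcal H$. Let $A_\ell,T_\ell$ be the solution operators of the discrete source problem on $\Sigma_\ell\times M_\ell$, let $0<\lambda_{\ell,1}\le\dots\le\lambda_{\ell,\dim M_\ell}$ be the discrete eigenvalues with $\mathcal H$-orthonormal eigenfunctions $u_{\ell,k}$, and let $W_\ell=\operatorname{span}\{u_{\ell,k}: k\in J,\ k\le\dim M_\ell\}$. Put $$\delta(W,W_\ell)=\sup_{u\in W,\ \|u\|_{\mathcal H}=1}\ \inf_{v\in W_\ell}\Big(\|u-v\|_{\mathcal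 H}^2+|\mathsf G(u)-\mathsf G_\ell(v)|_a^2\Big)^{1/2},$$ where $\mathsf G(u)\in\Sigma$ solves $a(\mathsf G(u),\tau)+b(\tau,u)=0$ for all $\tau\in\Sigma$ and $\mathsf G_\ell(v)\in\Sigma_\ell$ solves $a(\mathsf G_\ell(v),\tau)+b(\tau,v)=0$ for all $\tau\in\Sigma_\ell$. Let $F_\ell:W\to W_\ell$ be the restriction to $W$ of the $\mathcal H$-orthogonal projection onto $W_\ell$. Proposition. The continuous source problem has a unique solution for each $g\in\mathcal H$. Moreover: (i) For all $R\in\mathbb R$ and $\theta<1$ there is a constant $C$ such that for every discretization with constant $R$ and every choice of discrete eigenfunctions for which $\delta(W,W_\ell)\le\theta$, the discrete source problem is uniquely solvable, $T(W)\subseteq W$, $T_\ell(W_\ell)\subseteq W_\ell$, $F_\ell$ is bijective, and the operators $\hat T=T|_W$ and $\hat T_\ell=F_\ell^{-1}T_\ell F_\ell$ from $W$ into itself satisfy $$\|\hat T-\hat T_\ell\|_{\mathcal L(W)}\le C\,\delta(W,W_\ell)^2,$$ with $W$ normed by $\|\cdot\|_{\mathcal H}$. (ii) If $\lambda_i\ne\lambda_k$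 for all $i\in J$ and $k\notin J$, then there are $\rho_0>0$ and $C$ such that the whole conclusion of (i) holds, without any condition on $\delta(W,W_\ell)$, for every discretization with constant $\rho_0$ and every choice of discrete eigenfunctions. -/

import Mathlib

open scoped RealInnerProductSpace

noncomputable section

namespace MixedEVP

variable {S M H : Type*}
  [NormedAddCommGroup S] [InnerProductSpace ℝ S]
  [NormedAddCommGroup M] [InnerProductSpace ℝ M]
  [NormedAddCommGroup H] [InnerProductSpace ℝ H]

/-- The standing hypotheses on the spaces `M ⊆ H ⊆ M*` (the first inclusion is `j`) and on the
continuous bilinear forms `a` on `S × S` and `b` on `S × M`: `a` is symmetric, positive definite,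
and elliptic on the kernel of `b`; `b` satisfies the inf-sup condition
(`‖b.flip v‖` is the supremum of `b(τ, v) / ‖τ‖` over `τ ≠ 0`). -/
structure IsMixedSetting (j : M →L[ℝ] H) (a : S →L[ℝ] S →L[ℝ] ℝ) (b : S →L[ℝ] M →L[ℝ] ℝ) :
    Prop where
  embedding_injective : Function.Injective j
  embedding_dense : DenseRange j
  symm : ∀ σ τ : S, a σ τ = a τ σ
  pos : ∀ τ : S, τ ≠ 0 → 0 < a τ τ
  elliptic : ∃ α : ℝ, 0 < α ∧ ∀ τ : S, (∀ v : M, b τ v = 0) → α * ‖τ‖ ^ 2 ≤ a τ τ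
  inf_sup : ∃ β : ℝ, 0 < β ∧ ∀ v : M, β * ‖v‖ ≤ ‖b.flip v‖

/-- The norm `|τ|_a` associated with `a`. -/
def normA (a : S →L[ℝ] S →L[ℝ] ℝ) (τ : S) : ℝ := Real.sqrt (a τ τ)

/-- `(σ, u) ∈ Sh × Mh` solves the mixed source problem with datum `g` on the pair `(Sh, Mh)`.
The continuous problem is the case `Sh = ⊤`, `Mh = ⊤`. -/
def IsSourceSolution (j : M →L[ℝ] H) (a : S →L[ℝ] S →L[ℝ] ℝ) (b : S →L[ℝ] M →L[ℝ] ℝ)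
    (Sh : Submodule ℝ S) (Mh : Submodule ℝ M) (g : H) (σ : S) (u : M) : Prop :=
  σ ∈ Sh ∧ u ∈ Mh ∧ (∀ τ ∈ Sh, a σ τ + b τ u = 0) ∧ ∀ v ∈ Mh, b σ v = -⟪g, j v⟫

/-- The mixed eigenvalue equations (without normalization) for `(lam, σ, u)` on `(Sh, Mh)`. -/
def IsEigenSolution (j : M →L[ℝ] H) (a : S →L[ℝ] S →L[ℝ] ℝ) (b : S →L[ℝ] M →L[ℝ] ℝ)
    (Sh : Submodule ℝ S) (Mh : Submodule ℝ M) (lam : ℝ) (σ : S) (u : M) : Prop :=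
  σ ∈ Sh ∧ u ∈ Mh ∧ (∀ τ ∈ Sh, a σ τ + b τ u = 0) ∧ ∀ v ∈ Mh, b σ v = -lam * ⟪j u, j v⟫

open Classical in
/-- The pair of solution operators `g ↦ (A g, T g)` on `(Sh, Mh)`: the linear map that sends every
datum to a solution of the source problem (zero if there is no such map; see `WellPosed`). -/
def solutionPair (j : M →L[ℝ] H) (a : S →L[ℝ] S →L[ℝ] ℝ) (b : S →L[ℝ] M →L[ℝ] ℝ)
    (Sh : Submodule ℝ S) (Mh : Submodule ℝ M) : H →ₗ[ℝ] S × M :=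
  if h : ∃ P : H →ₗ[ℝ] S × M, ∀ g, IsSourceSolution j a b Sh Mh g (P g).1 (P g).2 then
    Classical.choose h
  else 0

/-- The solution operator `A` (`A_h` for a discrete pair). -/
def solA (j : M →L[ℝ] H) (a : S →L[ℝ] S →L[ℝ] ℝ) (b : S →L[ℝ] M →L[ℝ] ℝ)
    (Sh : Submodule ℝ S) (Mh : Submodule ℝ M) : H →ₗ[ℝ] S :=
  LinearMap.fst ℝ S M ∘ₗ solutionPair j a b Sh Mh

/-- The solution operator `T` (`T_h` for a discrete pair), with values in `M`. -/
def solT (j : M →L[ℝ] H) (a : S →L[ℝ] S →L[ℝ] ℝ) (b : S →L[ℝ] M →L[ℝ] ℝ)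
    (Sh : Submodule ℝ S) (Mh : Submodule ℝ M) : H →ₗ[ℝ] M :=
  LinearMap.snd ℝ S M ∘ₗ solutionPair j a b Sh Mh

/-- The solution operator `T` (or `T_h`), regarded as an operator from `H` into itself. -/
def solTH (j : M →L[ℝ] H) (a : S →L[ℝ] S →L[ℝ] ℝ) (b : S →L[ℝ] M →L[ℝ] ℝ)
    (Sh : Submodule ℝ S) (Mh : Submodule ℝ M) : H →ₗ[ℝ] H :=
  (j : M →ₗ[ℝ] H) ∘ₗ solT j a b Sh Mh

/-- For each datum `g` the source problem has exactly one solution, and it is `(A g, T g)`. -/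
def WellPosed (j : M →L[ℝ] H) (a : S →L[ℝ] S →L[ℝ] ℝ) (b : S →L[ℝ] M →L[ℝ] ℝ)
    (Sh : Submodule ℝ S) (Mh : Submodule ℝ M) : Prop :=
  ∀ (g : H) (σ : S) (u : M), IsSourceSolution j a b Sh Mh g σ u ↔
    σ = solA j a b Sh Mh g ∧ u = solT j a b Sh Mh g

/-- An enumeration, by an ordered index type, of all the eigenvalues on `(Sh, Mh)` in nondecreasing
order and repeated according to multiplicity, with eigenfunctions orthonormal in `H`. -/
structure IsEigensystem {I : Type*} [Preorder I] (j : M →L[ℝ] H) (a : S →L[ℝ] S →L[ℝ] ℝ)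
    (b : S →L[ℝ] M →L[ℝ] ℝ) (Sh : Submodule ℝ S) (Mh : Submodule ℝ M)
    (lam : I → ℝ) (sig : I → S) (u : I → M) : Prop where
  pos : ∀ i, 0 < lam i
  mono : Monotone lam
  orthonormal : Orthonormal ℝ (fun i => j (u i))
  eigen : ∀ i, IsEigenSolution j a b Sh Mh (lam i) (sig i) (u i)
  complete : ∀ (μ : ℝ) (σ : S) (v : M), IsEigenSolution j a b Sh Mh μ σ v →
    v ∈ Submodule.span ℝ (u '' {i | lam i = μ})

/-- `(Sh, Mh)` is a discretization with approximation constant `ρ`: finite-dimensional spaces,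
the commuting diagram relation `B(Sh) = Mh` (where `b(τ, v) = (Bτ, v)_H`), the Fortid condition and
the strong approximability; solutions of the source problem with datum `g` are measured by the
norm of `g`. -/
structure IsDiscretization (j : M →L[ℝ] H) (a : S →L[ℝ] S →L[ℝ] ℝ) (b : S →L[ℝ] M →L[ℝ] ℝ)
    (Sh : Submodule ℝ S) (Mh : Submodule ℝ M) (ρ : ℝ) : Prop where
  finite_S : FiniteDimensional ℝ Sh
  finite_M : FiniteDimensional ℝ Mh
  image_subset : ∀ τ ∈ Sh, ∃ w ∈ Mh, ∀ v : M, b τ v = ⟪j w, j v⟫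
  subset_image : ∀ w ∈ Mh, ∃ τ ∈ Sh, ∀ v : M, b τ v = ⟪j w, j v⟫
  fortid : ∀ (g : H) (σ : S) (u : M), IsSourceSolution j a b ⊤ ⊤ g σ u →
    ∃ σh ∈ Sh, (∀ v ∈ Mh, b (σ - σh) v = 0) ∧ normA a (σ - σh) ≤ ρ * ‖g‖
  strong_approx : ∀ (g : H) (σ : S) (u : M), IsSourceSolution j a b ⊤ ⊤ g σ u →
    (⨅ v : Mh, ‖j u - j (v : M)‖) ≤ ρ * ‖g‖

/-- The span of the eigenfunctions whose index lies in `J`. -/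
def clusterSpace {I : Type*} (u : I → M) (J : Set I) : Submodule ℝ M :=
  Submodule.span ℝ (u '' J)

instance clusterSpace_finiteDimensional {I : Type*} (u : I → M) (J : Set I) [Finite J] :
    FiniteDimensional ℝ (clusterSpace u J) :=
  FiniteDimensional.span_of_finite ℝ ((Set.toFinite J).image u)

/-- A subspace of `M`, regarded as a subspace of `H`. -/
abbrev inH (j : M →L[ℝ] H) (W : Submodule ℝ M) : Submodule ℝ H := W.map (j : M →ₗ[ℝ] H)

open Classical in
/-- `G(w)` (`G_h(w)` for a discrete space `Sh`): the `σ ∈ Sh` with `a(σ, τ) + b(τ, w) = 0` for all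
`τ ∈ Sh`, if it exists. -/
def G (a : S →L[ℝ] S →L[ℝ] ℝ) (b : S →L[ℝ] M →L[ℝ] ℝ) (Sh : Submodule ℝ S) (w : M) : S :=
  if h : ∃ σ ∈ Sh, ∀ τ ∈ Sh, a σ τ + b τ w = 0 then Classical.choose h else 0

/-- The distance `d(u, v)` of a continuous function `u` and a discrete function `v`. -/
def mixedDist (j : M →L[ℝ] H) (a : S →L[ℝ] S →L[ℝ] ℝ) (b : S →L[ℝ] M →L[ℝ] ℝ)
    (Sh : Submodule ℝ S) (u v : M) : ℝ :=
  Real.sqrt (‖j u - j v‖ ^ 2 + normA a (G a b ⊤ u - G a b Sh v) ^ 2)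

/-- The gap `δ(W, Wh)`. -/
def gap (j : M →L[ℝ] H) (a : S →L[ℝ] S →L[ℝ] ℝ) (b : S →L[ℝ] M →L[ℝ] ℝ)
    (Sh : Submodule ℝ S) (W Wh : Submodule ℝ M) : ℝ :=
  ⨆ u : {u : M // u ∈ W ∧ ‖j u‖ = 1}, ⨅ v : Wh, mixedDist j a b Sh (u : M) (v : M)

/-- `F_h : W → Wh`, the restriction to `W` of the `H`-orthogonal projection onto `Wh`. -/
def projF (W Wh : Submodule ℝ H) [FiniteDimensional ℝ Wh] : W →ₗ[ℝ] Wh :=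
  (Wh.orthogonalProjectionOnto : H →ₗ[ℝ] Wh) ∘ₗ W.subtype

/-- `F_h⁻¹ T_h F_h : W → W`, for `T_h` leaving `Wh` invariant and bijective `F_h`. -/
def hatTh (Th : H →ₗ[ℝ] H) (W Wh : Submodule ℝ H) [FiniteDimensional ℝ Wh]
    (hTh : ∀ x ∈ Wh, Th x ∈ Wh) (hF : Function.Bijective (projF W Wh)) : W →ₗ[ℝ] W :=
  ((LinearEquiv.ofBijective (projF W Wh) hF).symm : Wh →ₗ[ℝ] W) ∘ₗ
    Th.restrict hTh ∘ₗ projF W Wh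

/-- The operators `T|_W` and `F_h⁻¹ T_h F_h` from `W` into itself are well defined, and their
distance in the operator norm induced by the norm of `H` is at most `ε`. -/
def HatEstimate (T Th : H →ₗ[ℝ] H) (W Wh : Submodule ℝ H) [FiniteDimensional ℝ W]
    [FiniteDimensional ℝ Wh] (ε : ℝ) : Prop :=
  ∃ (hT : ∀ x ∈ W, T x ∈ W) (hTh : ∀ x ∈ Wh, Th x ∈ Wh) (hF : Function.Bijective (projF W Wh)),
    ‖LinearMap.toContinuousLinearMap (T.restrict hT - hatTh Th W Wh hTh hF)‖ ≤ ε

end MixedEVP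

end

noncomputable section

namespace MixedEVP

variable {S M H : Type*}
  [NormedAddCommGroup S] [InnerProductSpace ℝ S]
  [NormedAddCommGroup M] [InnerProductSpace ℝ M]
  [NormedAddCommGroup H] [InnerProductSpace ℝ H]
  {j : M →L[ℝ] H} {a : S →L[ℝ] S →L[ℝ] ℝ} {b : S →L[ℝ] M →L[ℝ] ℝ}
  {Sh : Submodule ℝ S} {Mh : Submodule ℝ M}

/-! ### The seminorm of `a` -/

/-! On `W` the difference of the two operators is `F⁻¹(F T - T_h F)`, and a gap at most `θ < 1`
bounds `F⁻¹` by `1 / (1 - θ)`. It remains to bound `w = F T x - T_h F x` by `δ²`. The relation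
`B(Sh) = Mh` turns `‖w‖²` into `a(A_h w, A x - σ)` for every `σ ∈ Sh` with the discrete constraint
of `A x` (`inner_solT_sub`). Since `T_h w` lies in `Wh`, it is `F y` for some `y ∈ W`, and `A_h w =
G_h(F y)`. With `G y` in place of `G_h(F y)` the product is at most the product of two projection
errors in `H`, hence `O(δ²)` (`abs_a_G_le`); the exchange costs `O(δ) |A x - σ|_a`. The Fortin
interpolant as `σ` gives `‖w‖ = O(δ)`. This yields `|A x - A_h x|_a = O(δ)`, and a second pass with
`σ = A_h x` gives `O(δ²)` (`norm_commutator_le_sq`).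

The constant is uniform because the Fortin condition bounds `A_h`, and because the gap alone bounds
the discrete eigenvalues of the cluster (`lam_le_of_mixedDist_lt`).

For a separated cluster, `T_h` tends to `T` in norm at rate `ρ`, Weyl's inequality moves the
reciprocal eigenvalues by as little, and a residual argument makes the projection errors of the
eigenfunctions small. So the gap is at most `1/2` for small `ρ` (`exists_gap_le`), and the
conditional estimate applies. -/

lemma IsMixedSetting.a_self_nonneg (hs : IsMixedSetting j a b) (τ : S) : 0 ≤ a τ τ := by
  rcases eq_or_ne τ 0 with rfl | h
  · simp
  · exact (hs.pos τ h).le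

lemma IsMixedSetting.eq_zero_of_a_self (hs : IsMixedSetting j a b) {τ : S} (h : a τ τ = 0) :
    τ = 0 := by
  by_contra hne
  exact (hs.pos τ hne).ne' h

lemma normA_nonneg (τ : S) : 0 ≤ normA a τ := Real.sqrt_nonneg _

lemma normA_zero : normA a (0 : S) = 0 := by simp [normA]

lemma IsMixedSetting.normA_sq (hs : IsMixedSetting j a b) (τ : S) : normA a τ ^ 2 = a τ τ :=
  Real.sq_sqrt (hs.a_self_nonneg τ)

lemma IsMixedSetting.abs_a_le (hs : IsMixedSetting j a b) (σ τ : S) :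
    |a σ τ| ≤ normA a σ * normA a τ := by
  apply abs_le_of_sq_le_sq _ (mul_nonneg (normA_nonneg σ) (normA_nonneg τ))
  rw [mul_pow, hs.normA_sq, hs.normA_sq]
  have h := LinearMap.BilinForm.apply_mul_apply_le_of_forall_zero_le
    (ContinuousLinearMap.toLinearMap₁₂ a) (fun x => hs.a_self_nonneg x) σ τ
  change a σ τ * a τ σ ≤ a σ σ * a τ τ at h
  rw [hs.symm τ σ] at h
  nlinarith [h]

lemma IsMixedSetting.a_le (hs : IsMixedSetting j a b) (σ τ : S) :
    a σ τ ≤ normA a σ * normA a τ := (le_abs_self _).trans (hs.abs_a_le σ τ)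

lemma IsMixedSetting.normA_add_le (hs : IsMixedSetting j a b) (σ τ : S) :
    normA a (σ + τ) ≤ normA a σ + normA a τ := by
  apply le_of_sq_le_sq _ (add_nonneg (normA_nonneg σ) (normA_nonneg τ))
  rw [hs.normA_sq, add_sq, hs.normA_sq, hs.normA_sq]
  simp only [map_add, add_apply]
  have := hs.a_le σ τ
  rw [hs.symm τ σ]
  linarith

lemma normA_smul (c : ℝ) (τ : S) : normA a (c • τ) = |c| * normA a τ := by
  simp only [normA, map_smul, smul_apply, smul_eq_mul]
  rw [← mul_assoc, Real.sqrt_mul (mul_self_nonneg c), Real.sqrt_mul_self_eq_abs]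

lemma normA_neg (τ : S) : normA a (-τ) = normA a τ := by simp [normA]

lemma normA_sub_comm (σ τ : S) : normA a (σ - τ) = normA a (τ - σ) := by
  rw [← normA_neg, neg_sub]

lemma IsMixedSetting.normA_le_add_sub (hs : IsMixedSetting j a b) (σ τ : S) :
    normA a σ ≤ normA a τ + normA a (σ - τ) := by
  simpa using hs.normA_add_le τ (σ - τ)

lemma IsMixedSetting.normA_sub_le (hs : IsMixedSetting j a b) (σ τ υ : S) :
    normA a (σ - υ) ≤ normA a (σ - τ) + normA a (τ - υ) := by
  simpa using hs.normA_add_le (σ - τ) (τ - υ)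

/-! ### Well-posedness -/

lemma IsMixedSetting.eq_zero_of_b (hs : IsMixedSetting j a b) {v : M} (h : ∀ τ, b τ v = 0) :
    v = 0 := by
  obtain ⟨β, hβ, hb⟩ := hs.inf_sup
  have h0 : b.flip v = 0 := by ext τ; simpa using h τ
  have h1 := hb v
  rw [h0, norm_zero] at h1
  have : ‖v‖ ≤ 0 := by
    by_contra hc
    nlinarith [mul_pos hβ (not_le.1 hc)]
  simpa using this

lemma IsSourceSolution.add {g g' : H} {σ σ' : S} {u u' : M}
    (h : IsSourceSolution j a b Sh Mh g σ u) (h' : IsSourceSolution j a b Sh Mh g' σ' u') :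
    IsSourceSolution j a b Sh Mh (g + g') (σ + σ') (u + u') := by
  refine ⟨Sh.add_mem h.1 h'.1, Mh.add_mem h.2.1 h'.2.1, fun τ hτ => ?_, fun v hv => ?_⟩
  · have := h.2.2.1 τ hτ; have := h'.2.2.1 τ hτ
    simp only [map_add, add_apply]; linarith
  · have := h.2.2.2 v hv; have := h'.2.2.2 v hv
    simp only [map_add, add_apply, inner_add_left]; linarith

lemma IsSourceSolution.smul {g : H} {σ : S} {u : M} (c : ℝ)
    (h : IsSourceSolution j a b Sh Mh g σ u) :
    IsSourceSolution j a b Sh Mh (c • g) (c • σ) (c • u) := by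
  refine ⟨Sh.smul_mem c h.1, Mh.smul_mem c h.2.1, fun τ hτ => ?_, fun v hv => ?_⟩
  · have := h.2.2.1 τ hτ
    simp only [map_smul, smul_apply, smul_eq_mul]; rw [← mul_add, this, mul_zero]
  · have := h.2.2.2 v hv
    simp only [map_smul, smul_apply, smul_eq_mul, inner_smul_left, this]
    simp

/-- Uniqueness makes any choice of solutions linear in the datum, so the default value in
`solutionPair` is not taken. -/
lemma wellPosed_of_exists_of_unique
    (hex : ∀ g : H, ∃ (σ : S) (u : M), IsSourceSolution j a b Sh Mh g σ u)
    (huniq : ∀ (σ : S) (u : M), IsSourceSolution j a b Sh Mh 0 σ u → σ = 0 ∧ u = 0) :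
    WellPosed j a b Sh Mh := by
  have huniq' : ∀ (g : H) (σ σ' : S) (u u' : M), IsSourceSolution j a b Sh Mh g σ u →
      IsSourceSolution j a b Sh Mh g σ' u' → σ = σ' ∧ u = u' := by
    intro g σ σ' u u' h h'
    have h1 := h.add (h'.smul (-1))
    have h2 := huniq (σ + (-1 : ℝ) • σ') (u + (-1 : ℝ) • u') (by simpa using h1)
    simpa [← sub_eq_add_neg, sub_eq_zero] using h2
  choose σ u hσu using hex
  let P : H →ₗ[ℝ] S × M :=
    { toFun := fun g => (σ g, u g)
      map_add' := fun g g' => by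
        obtain ⟨h1, h2⟩ := huniq' _ _ _ _ _ (hσu (g + g')) ((hσu g).add (hσu g'))
        ext <;> simp [h1, h2]
      map_smul' := fun c g => by
        obtain ⟨h1, h2⟩ := huniq' _ _ _ _ _ (hσu (c • g)) ((hσu g).smul c)
        ext <;> simp [h1, h2] }
  have h : ∃ P : H →ₗ[ℝ] S × M, ∀ g, IsSourceSolution j a b Sh Mh g (P g).1 (P g).2 :=
    ⟨P, hσu⟩
  have hsol : ∀ g, IsSourceSolution j a b Sh Mh g (solA j a b Sh Mh g) (solT j a b Sh Mh g) := by
    intro g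
    have := Classical.choose_spec h g
    simpa [solA, solT, solutionPair, dif_pos h] using this
  intro g σ' u'
  constructor
  · intro h'
    exact huniq' _ _ _ _ _ h' (hsol g)
  · rintro ⟨rfl, rfl⟩
    exact hsol g

/-! ### Brezzi theory for the continuous problem -/

section Brezzi

variable [CompleteSpace S]

/-- The operator `M → S` that represents `b`. -/
def rieszB (b : S →L[ℝ] M →L[ℝ] ℝ) : M →L[ℝ] S :=
  LinearMap.mkContinuous
    { toFun := fun v => (InnerProductSpace.toDual ℝ S).symm (b.flip v)
      map_add' := fun v w => by simp
      map_smul' := fun c v => by simp } ‖b.flip‖ (fun v => by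
        simpa using b.flip.le_opNorm v)

lemma inner_rieszB (v : M) (τ : S) : ⟪rieszB b v, τ⟫ = b τ v := by
  simp [rieszB]

lemma norm_rieszB (v : M) : ‖rieszB b v‖ = ‖b.flip v‖ := by
  simp [rieszB]

variable [CompleteSpace M]

/-- The inf-sup condition bounds `rieszB b` from below, so its range is closed and equals its double
orthogonal complement. The orthogonal complement of the range is the kernel of `b`, on which `f`
vanishes. -/
lemma IsMixedSetting.exists_multiplier (hs : IsMixedSetting j a b) (f : S →L[ℝ] ℝ)
    (hf : ∀ τ, (∀ v, b τ v = 0) → f τ = 0) : ∃ u : M, ∀ τ, f τ + b τ u = 0 := by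
  obtain ⟨β, hβ, hb⟩ := hs.inf_sup
  have hcl : IsClosed ((rieszB b).range : Set S) := by
    have : AntilipschitzWith (β⁻¹).toNNReal (rieszB b) := by
      refine ContinuousLinearMap.antilipschitz_of_bound _ fun v => ?_
      rw [Real.coe_toNNReal _ (inv_nonneg.2 hβ.le), norm_rieszB, inv_mul_eq_div,
        le_div_iff₀ hβ, mul_comm]
      exact hb v
    exact this.isClosed_range (rieszB b).uniformContinuous
  have hmem : (InnerProductSpace.toDual ℝ S).symm f ∈ (rieszB b).range := by
    have := hcl.completeSpace_coe
    rw [← (rieszB b).range.orthogonal_orthogonal, Submodule.mem_orthogonal']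
    intro τ hτ
    rw [InnerProductSpace.toDual_symm_apply]
    refine hf τ fun v => ?_
    rw [← inner_rieszB]
    exact hτ _ ⟨v, rfl⟩
  obtain ⟨u, hu⟩ := hmem
  refine ⟨-u, fun τ => ?_⟩
  have h1 : ⟪rieszB b u, τ⟫ = f τ := by
    have hu' : rieszB b u = (InnerProductSpace.toDual ℝ S).symm f := hu
    rw [hu', InnerProductSpace.toDual_symm_apply]
  rw [inner_rieszB] at h1
  simp [h1]

/-- Lax–Milgram for `B B*`: the inf-sup condition makes this form on `M` coercive with constant `β ^
2`. -/
lemma IsMixedSetting.exists_b_eq (hs : IsMixedSetting j a b) (f : M →L[ℝ] ℝ) :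
    ∃ σ : S, ∀ v, b σ v = f v := by
  obtain ⟨β, hβ, hb⟩ := hs.inf_sup
  let C : M →L[ℝ] M →L[ℝ] ℝ := b ∘L rieszB b
  have hC : IsCoercive C := by
    refine ⟨β ^ 2, by positivity, fun v => ?_⟩
    have h1 : C v v = ‖rieszB b v‖ ^ 2 := by
      rw [← real_inner_self_eq_norm_sq, inner_rieszB]; rfl
    have h2 := hb v
    rw [h1, norm_rieszB]
    have : 0 ≤ β * ‖v‖ := by positivity
    nlinarith
  refine ⟨rieszB b (hC.continuousLinearEquivOfBilin.symm
    ((InnerProductSpace.toDual ℝ M).symm f)), fun v => ?_⟩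
  change C _ v = f v
  rw [← hC.continuousLinearEquivOfBilin_apply]
  simp

theorem IsMixedSetting.wellPosed (hs : IsMixedSetting j a b) : WellPosed j a b ⊤ ⊤ := by
  apply wellPosed_of_exists_of_unique
  · intro g
    obtain ⟨σ₀, hσ₀⟩ := hs.exists_b_eq (-(innerSL ℝ g ∘L j))
    obtain ⟨α, hα, hell⟩ := hs.elliptic
    let K : Submodule ℝ S := b.ker
    have hK : IsClosed (K : Set S) := b.isClosed_ker
    have := hK.completeSpace_coe
    have hKb : ∀ τ : K, ∀ v, b τ v = 0 := fun τ v => by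
      have : b τ = 0 := τ.2
      simp [this]
    let aK : K →L[ℝ] K →L[ℝ] ℝ := a.bilinearComp K.subtypeL K.subtypeL
    have haK : IsCoercive aK :=
      ⟨α, hα, fun τ => by simpa [aK, pow_two, mul_assoc] using hell τ (hKb τ)⟩
    -- The correction by Lax–Milgram on the kernel makes `σ₀ + σ₁` `a`-orthogonal to the kernel, as
    -- `exists_multiplier` requires.
    set σ₁ : K := haK.continuousLinearEquivOfBilin.symm
      ((InnerProductSpace.toDual ℝ K).symm (-(a σ₀ ∘L K.subtypeL))) with hσ₁def
    have hσ₁ : ∀ τ : K, a σ₁ τ = -a σ₀ τ := fun τ => by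
      change aK σ₁ τ = _
      rw [← haK.continuousLinearEquivOfBilin_apply, hσ₁def]
      simp
    obtain ⟨u, hu⟩ := hs.exists_multiplier (a (σ₀ + σ₁)) (fun τ hτ => by
      have hτK : τ ∈ K := by
        change b τ = 0
        ext v; simp [hτ v]
      have := hσ₁ ⟨τ, hτK⟩
      simp only [map_add, add_apply]
      simp only at this
      linarith)
    refine ⟨σ₀ + σ₁, u, trivial, trivial, fun τ _ => hu τ, fun v _ => ?_⟩
    rw [map_add, add_apply, hKb, hσ₀]
    simp
  · rintro σ u ⟨-, -, h1, h2⟩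
    have hσ : σ = 0 := by
      apply hs.eq_zero_of_a_self
      have := h1 σ trivial
      rw [h2 u trivial] at this
      simpa using this
    refine ⟨hσ, hs.eq_zero_of_b fun τ => ?_⟩
    simpa [hσ] using h1 τ trivial

end Brezzi

/-! ### Solvability of the discrete problem -/

section Discrete

variable {R : ℝ}

/-- The discrete kernel lies in the kernel of `b`: the functional is represented by an element of
`Mh`, which may be tested with itself. -/
lemma IsDiscretization.b_eq_zero (hd : IsDiscretization j a b Sh Mh R) {σ : S} (hσ : σ ∈ Sh)
    (h : ∀ v ∈ Mh, b σ v = 0) (v : M) : b σ v = 0 := by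
  obtain ⟨w, hw, hb⟩ := hd.image_subset σ hσ
  have : j w = 0 := by
    have := h w hw
    rw [hb, real_inner_self_eq_norm_sq] at this
    simpa using this
  rw [hb, this, inner_zero_left]

/-- The system is square, so injectivity suffices. The multiplier vanishes because it is itself the
representative of some `b τ` with `τ ∈ Sh`. -/
theorem IsDiscretization.wellPosed (hs : IsMixedSetting j a b)
    (hd : IsDiscretization j a b Sh Mh R) : WellPosed j a b Sh Mh := by
  have := hd.finite_S
  have := hd.finite_M
  have huniq : ∀ (σ : S) (u : M), σ ∈ Sh → u ∈ Mh → (∀ τ ∈ Sh, a σ τ + b τ u = 0) →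
      (∀ v ∈ Mh, b σ v = 0) → σ = 0 ∧ u = 0 := by
    intro σ u hσS huM h1 h2
    have hσ : σ = 0 := by
      apply hs.eq_zero_of_a_self
      simpa [h2 u huM] using h1 σ hσS
    refine ⟨hσ, ?_⟩
    obtain ⟨τ, hτ, hb⟩ := hd.subset_image u huM
    have := h1 τ hτ
    rw [hb, real_inner_self_eq_norm_sq] at this
    apply hs.embedding_injective
    simpa [hσ] using this
  apply wellPosed_of_exists_of_unique
  · intro g
    let L : Sh × Mh →ₗ[ℝ] Module.Dual ℝ Sh × Module.Dual ℝ Mh :=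
      { toFun := fun p => ((((a (p.1 : S)) + b.flip (p.2 : M)) : S →ₗ[ℝ] ℝ) ∘ₗ Sh.subtype,
          (b (p.1 : S) : M →ₗ[ℝ] ℝ) ∘ₗ Mh.subtype)
        map_add' := fun p q => by ext <;> simp; ring
        map_smul' := fun c p => by ext <;> simp; ring }
    have hinj : Function.Injective L := by
      rw [← LinearMap.ker_eq_bot, LinearMap.ker_eq_bot']
      rintro ⟨σ, u⟩ h
      have h1 : ∀ τ : Sh, a σ τ + b τ u = 0 := fun τ =>
        LinearMap.congr_fun (congrArg Prod.fst h) τ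
      have h2 : ∀ v : Mh, b σ v = 0 := fun v => LinearMap.congr_fun (congrArg Prod.snd h) v
      obtain ⟨h3, h4⟩ := huniq σ u σ.2 u.2 (fun τ hτ => h1 ⟨τ, hτ⟩) (fun v hv => h2 ⟨v, hv⟩)
      ext <;> simp [h3, h4]
    have hsurj : Function.Surjective L :=
      (LinearMap.injective_iff_surjective_of_finrank_eq_finrank (by
        simp [Module.finrank_prod, Subspace.dual_finrank_eq])).1 hinj
    obtain ⟨⟨σ, u⟩, h⟩ := hsurj (0, -((innerSL ℝ g ∘L j : M →L[ℝ] ℝ) : M →ₗ[ℝ] ℝ) ∘ₗ Mh.subtype)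
    refine ⟨σ, u, σ.2, u.2, fun τ hτ => ?_, fun v hv => ?_⟩
    · exact LinearMap.congr_fun (congrArg Prod.fst h) ⟨τ, hτ⟩
    · exact LinearMap.congr_fun (congrArg Prod.snd h) ⟨v, hv⟩
  · rintro σ u ⟨hσ, hu, h1, h2⟩
    exact huniq σ u hσ hu h1 (by simpa using h2)

end Discrete

/-! ### Properties of the solution operators -/

lemma G_eq (hs : IsMixedSetting j a b) {σ : S} {w : M} (hσ : σ ∈ Sh)
    (h : ∀ τ ∈ Sh, a σ τ + b τ w = 0) : G a b Sh w = σ := by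
  have hex : ∃ σ ∈ Sh, ∀ τ ∈ Sh, a σ τ + b τ w = 0 := ⟨σ, hσ, h⟩
  obtain ⟨h1, h2⟩ := Classical.choose_spec hex
  rw [G, dif_pos hex]
  set σ' := Classical.choose hex
  rw [← sub_eq_zero]
  apply hs.eq_zero_of_a_self
  have hm : σ' - σ ∈ Sh := Sh.sub_mem h1 hσ
  have h3 := h _ hm
  have h4 := h2 _ hm
  rw [map_sub a, sub_apply]
  linarith

namespace WellPosed

lemma source (hw : WellPosed j a b Sh Mh) (g : H) :
    IsSourceSolution j a b Sh Mh g (solA j a b Sh Mh g) (solT j a b Sh Mh g) :=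
  (hw g _ _).2 ⟨rfl, rfl⟩

lemma G_solT (hw : WellPosed j a b Sh Mh) (hs : IsMixedSetting j a b) (g : H) :
    G a b Sh (solT j a b Sh Mh g) = solA j a b Sh Mh g :=
  G_eq hs (hw.source g).1 (hw.source g).2.2.1

lemma a_solA (hw : WellPosed j a b Sh Mh) (f g : H) :
    a (solA j a b Sh Mh f) (solA j a b Sh Mh g) = ⟪g, j (solT j a b Sh Mh f)⟫ := by
  have h1 := (hw.source f).2.2.1 _ (hw.source g).1
  have h2 := (hw.source g).2.2.2 _ (hw.source f).2.1
  linarith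

lemma inner_solT_comm (hw : WellPosed j a b Sh Mh) (hs : IsMixedSetting j a b) (f g : H) :
    ⟪g, j (solT j a b Sh Mh f)⟫ = ⟪f, j (solT j a b Sh Mh g)⟫ := by
  rw [← hw.a_solA, ← hw.a_solA, hs.symm]

/-- For `f = T g` one has `‖f‖² = a(A g, A f)`, so the bound for `A` enters twice. -/
lemma norm_solT_le (hw : WellPosed j a b Sh Mh) (hs : IsMixedSetting j a b) {K : ℝ}
    (hK : ∀ g : H, normA a (solA j a b Sh Mh g) ≤ K * ‖g‖) (g : H) :
    ‖j (solT j a b Sh Mh g)‖ ≤ K ^ 2 * ‖g‖ := by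
  set f := j (solT j a b Sh Mh g) with hf
  have h1 : ‖f‖ ^ 2 ≤ (K * ‖g‖) * (K * ‖f‖) := by
    rw [← real_inner_self_eq_norm_sq]
    nth_rewrite 2 [hf]
    rw [← hw.a_solA]
    refine (hs.a_le _ _).trans ?_
    exact mul_le_mul (hK g) (hK f) (normA_nonneg _) ((normA_nonneg _).trans (hK g))
  rcases (norm_nonneg f).eq_or_lt with h0 | h0
  · rw [← h0]; positivity
  · by_contra hc
    nlinarith [mul_lt_mul_of_pos_right (not_le.1 hc) h0]

/-- `T g = 0` forces `|A g|_a² = (g, T g) = 0`, and then `g` annihilates the dense range of `j`. -/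
lemma solT_injective (hw : WellPosed j a b ⊤ ⊤) (hs : IsMixedSetting j a b) {g : H}
    (h : solT j a b ⊤ ⊤ g = 0) : g = 0 := by
  have h1 : solA j a b ⊤ ⊤ g = 0 := by
    apply hs.eq_zero_of_a_self
    rw [hw.a_solA, h, map_zero, inner_zero_right]
  have h2 : ∀ v, ⟪g, j v⟫ = 0 := fun v => by
    have := (hw.source g).2.2.2 v trivial
    simpa [h1] using this
  have h3 : ∀ x : H, ⟪g, x⟫ = 0 := fun x =>
    hs.embedding_dense.induction_on (p := fun x => ⟪g, x⟫ = 0) x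
      (isClosed_eq (by fun_prop) continuous_const) h2
  exact inner_self_eq_zero.1 (h3 g)

end WellPosed

lemma exists_normA_solA_le (hw : WellPosed j a b Sh Mh) (hs : IsMixedSetting j a b)
    (hc : IsCompactOperator (solTH j a b Sh Mh)) :
    ∃ K : ℝ, 0 ≤ K ∧ ∀ g : H, normA a (solA j a b Sh Mh g) ≤ K * ‖g‖ := by
  let T : H →L[ℝ] H := ContinuousLinearMap.mkOfIsCompactOperator hc
  refine ⟨Real.sqrt ‖T‖, Real.sqrt_nonneg _, fun g => ?_⟩
  apply le_of_sq_le_sq _ (by positivity)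
  rw [hs.normA_sq, hw.a_solA, mul_pow, Real.sq_sqrt (norm_nonneg _)]
  calc ⟪g, T g⟫ ≤ ‖g‖ * ‖T g‖ := real_inner_le_norm _ _
    _ ≤ ‖g‖ * (‖T‖ * ‖g‖) := by gcongr; exact T.le_opNorm g
    _ = ‖T‖ * ‖g‖ ^ 2 := by ring

/-! ### Stability of the discrete flux -/

namespace IsDiscretization

variable {R : ℝ}

lemma a_solA_sub_eq_zero (hd : IsDiscretization j a b Sh Mh R) (hwh : WellPosed j a b Sh Mh)
    (g : H) {τ : S} (hτ : τ ∈ Sh) (h : ∀ v ∈ Mh, b τ v = 0) (x : M) :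
    a (solA j a b Sh Mh g) τ = 0 ∧ b τ x = 0 := by
  have h1 := (hwh.source g).2.2.1 τ hτ
  rw [hd.b_eq_zero hτ h, add_zero] at h1
  exact ⟨h1, hd.b_eq_zero hτ h x⟩

/-- `A_h g` is `a`-orthogonal to the discrete kernel, hence has least `a`-norm among all elements of
`Sh` with its constraint; the Fortin interpolant of `A g` is one of them. -/
lemma normA_solA_le (hd : IsDiscretization j a b Sh Mh R) (hs : IsMixedSetting j a b)
    (hw : WellPosed j a b ⊤ ⊤) (hwh : WellPosed j a b Sh Mh) {K : ℝ}
    (hK : ∀ g : H, normA a (solA j a b ⊤ ⊤ g) ≤ K * ‖g‖) (g : H) :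
    normA a (solA j a b Sh Mh g) ≤ (K + R) * ‖g‖ := by
  obtain ⟨σ, hσ, hb, hle⟩ := hd.fortid g _ _ (hw.source g)
  have h0 : a (solA j a b Sh Mh g) (solA j a b Sh Mh g - σ) = 0 := by
    refine (hd.a_solA_sub_eq_zero hwh g (Sh.sub_mem (hwh.source g).1 hσ) (fun v hv => ?_) 0).1
    have h1 := (hwh.source g).2.2.2 v hv
    have h2 := (hw.source g).2.2.2 v trivial
    have h3 := hb v hv
    simp only [map_sub, sub_apply] at h3 ⊢
    linarith
  have h1 : normA a σ ≤ (K + R) * ‖g‖ := by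
    have := hs.normA_le_add_sub σ (solA j a b ⊤ ⊤ g)
    rw [normA_sub_comm] at this
    linarith [hK g]
  have h2 : normA a (solA j a b Sh Mh g) ^ 2 ≤ normA a (solA j a b Sh Mh g) * normA a σ := by
    rw [hs.normA_sq]
    rw [map_sub, sub_eq_zero] at h0
    rw [h0]
    exact hs.a_le _ _
  rcases (normA_nonneg (a := a) (solA j a b Sh Mh g)).eq_or_lt with h3 | h3
  · rw [← h3]
    exact (normA_nonneg σ).trans h1
  · rw [pow_two] at h2
    exact (le_of_mul_le_mul_left h2 h3).trans h1

/-- The gain over the discrete equation is that `v` need not lie in `Mh`: the representative of `b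
(A_h w)` is in `Mh`, so it must be `-w`. -/
lemma b_solA (hd : IsDiscretization j a b Sh Mh R) (hwh : WellPosed j a b Sh Mh) {w : M}
    (hw : w ∈ Mh) (v : M) : b (solA j a b Sh Mh (j w)) v = -⟪j w, j v⟫ := by
  obtain ⟨w', hw', hb⟩ := hd.image_subset _ (hwh.source (j w)).1
  have h1 : j (w' + w) = 0 := by
    rw [← inner_self_eq_zero (𝕜 := ℝ)]
    have h2 := (hwh.source (j w)).2.2.2 _ (Mh.add_mem hw' hw)
    rw [hb] at h2
    rw [map_add, inner_add_left] at *
    linarith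
  rw [hb, ← inner_neg_left]
  rw [map_add, add_eq_zero_iff_eq_neg] at h1
  rw [h1]

end IsDiscretization

/-! ### Spans of eigenfunctions -/

section Cluster

variable {I : Type*} {u : I → M} {J : Set I}

lemma mem_clusterSpace (u : I → M) {i : I} (hi : i ∈ J) : u i ∈ clusterSpace u J :=
  Submodule.subset_span ⟨i, hi, rfl⟩

lemma clusterSpace_le (h : ∀ k ∈ J, u k ∈ Mh) : clusterSpace u J ≤ Mh :=
  Submodule.span_le.2 (by rintro _ ⟨k, hk, rfl⟩; exact h k hk)

lemma exists_sum_of_mem_clusterSpace (ho : Orthonormal ℝ fun i => j (u i)) (hJ : J.Finite)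
    {w : M} (hw : w ∈ clusterSpace u J) :
    w = ∑ i ∈ hJ.toFinset, ⟪j (u i), j w⟫ • u i ∧
      ‖j w‖ ^ 2 = ∑ i ∈ hJ.toFinset, ⟪j (u i), j w⟫ ^ 2 := by
  have h1 : w = ∑ i ∈ hJ.toFinset, ⟪j (u i), j w⟫ • u i := by
    rw [clusterSpace, ← hJ.coe_toFinset] at hw
    obtain ⟨c, hc⟩ := (Submodule.mem_span_image_finset_iff_exists_fun' ℝ).1 hw
    have hci : ∀ i ∈ hJ.toFinset, ⟪j (u i), j w⟫ = c i := fun i hi => by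
      rw [← hc, map_sum]
      simp only [map_smul]
      exact ho.inner_right_sum c hi
    rw [Finset.sum_congr rfl fun i hi => by rw [hci i hi], hc]
  refine ⟨h1, ?_⟩
  rw [← real_inner_self_eq_norm_sq]
  nth_rewrite 1 [h1]
  rw [map_sum, sum_inner]
  refine Finset.sum_congr rfl fun i _ => ?_
  rw [map_smul, real_inner_smul_left, pow_two]

lemma norm_sum_sq (ho : Orthonormal ℝ fun i => j (u i)) (s : Finset I) (c : I → ℝ) :
    ‖j (∑ i ∈ s, c i • u i)‖ ^ 2 = ∑ i ∈ s, c i ^ 2 := by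
  rw [← real_inner_self_eq_norm_sq, map_sum]
  simp only [map_smul]
  rw [ho.inner_sum]
  simp [pow_two]

lemma finrank_clusterSpace [Finite J] (ho : Orthonormal ℝ fun i => j (u i)) :
    Module.finrank ℝ (clusterSpace u J) = J.ncard := by
  have hli : LinearIndependent ℝ u := by
    have := ho.linearIndependent
    exact LinearIndependent.of_comp (j : M →ₗ[ℝ] H) this
  have := Fintype.ofFinite J
  rw [clusterSpace, Set.image_eq_range,
    finrank_span_eq_card (b := fun x : J => u x)
      (hli.comp (Subtype.val : J → I) Subtype.val_injective), Set.ncard_eq_toFinset_card', Set.toFinset_card]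

end Cluster

namespace IsEigensystem

variable {I : Type*} [Preorder I] {lam : I → ℝ} {sig : I → S} {u : I → M} {J : Set I}

lemma sol (he : IsEigensystem j a b Sh Mh lam sig u) (hw : WellPosed j a b Sh Mh) (i : I) :
    sig i = solA j a b Sh Mh (lam i • j (u i)) ∧ u i = solT j a b Sh Mh (lam i • j (u i)) := by
  obtain ⟨h1, h2, h3, h4⟩ := he.eigen i
  exact (hw _ _ _).1 ⟨h1, h2, h3, fun v hv => by
    rw [h4 v hv, real_inner_smul_left, neg_mul]⟩

lemma solT_apply (he : IsEigensystem j a b Sh Mh lam sig u) (hw : WellPosed j a b Sh Mh) (i : I) :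
    solT j a b Sh Mh (j (u i)) = (lam i)⁻¹ • u i := by
  have h := (he.sol hw i).2
  rw [map_smul] at h
  rw [eq_inv_smul_iff₀ (he.pos i).ne', ← h]

lemma a_sig (he : IsEigensystem j a b Sh Mh lam sig u) {i : I} {w : M} {σ : S}
    (hw : w ∈ Mh) (h : ∀ τ ∈ Sh, a σ τ + b τ w = 0) :
    a σ (sig i) = lam i * ⟪j (u i), j w⟫ := by
  obtain ⟨h1, h2, h3, h4⟩ := he.eigen i
  have := h _ h1
  rw [h4 _ hw] at this
  linarith

lemma solT_mem (he : IsEigensystem j a b Sh Mh lam sig u) (hw : WellPosed j a b Sh Mh)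
    {w : M} (h : w ∈ clusterSpace u J) : solT j a b Sh Mh (j w) ∈ clusterSpace u J := by
  have : clusterSpace u J ≤
      (clusterSpace u J).comap (solT j a b Sh Mh ∘ₗ (j : M →ₗ[ℝ] H)) := by
    apply clusterSpace_le
    intro k hk
    change solT j a b Sh Mh (j (u k)) ∈ clusterSpace u J
    rw [he.solT_apply hw]
    exact Submodule.smul_mem _ _ (mem_clusterSpace u hk)
  exact this h

/-- On the cluster the solution operator is diagonal with entries `1 / lam i`, so its inverse is
bounded by the largest eigenvalue. -/
lemma exists_solT_eq (he : IsEigensystem j a b Sh Mh lam sig u) (hw : WellPosed j a b Sh Mh)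
    (hJ : J.Finite) {L : ℝ} (hL : ∀ i ∈ J, lam i ≤ L) (hL0 : 0 ≤ L)
    {w : M} (h : w ∈ clusterSpace u J) :
    ∃ g ∈ clusterSpace u J, solT j a b Sh Mh (j g) = w ∧ ‖j g‖ ≤ L * ‖j w‖ := by
  obtain ⟨h1, h2⟩ := exists_sum_of_mem_clusterSpace he.orthonormal hJ h
  refine ⟨∑ i ∈ hJ.toFinset, (lam i * ⟪j (u i), j w⟫) • u i, ?_, ?_, ?_⟩
  · exact Submodule.sum_mem _ fun i hi =>
      Submodule.smul_mem _ _ (mem_clusterSpace u (hJ.mem_toFinset.1 hi))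
  · simp only [map_sum, map_smul]
    nth_rewrite 2 [h1]
    refine Finset.sum_congr rfl fun i _ => ?_
    rw [he.solT_apply hw, smul_smul]
    congr 1
    have := (he.pos i).ne'
    field_simp
  · apply le_of_sq_le_sq _ (by positivity)
    rw [norm_sum_sq he.orthonormal, mul_pow, h2, Finset.mul_sum]
    refine Finset.sum_le_sum fun i hi => ?_
    rw [mul_pow]
    have := hL i (hJ.mem_toFinset.1 hi)
    have := he.pos i
    gcongr

lemma normA_G_le (he : IsEigensystem j a b Sh Mh lam sig u) (hw : WellPosed j a b Sh Mh)
    (hs : IsMixedSetting j a b) (hJ : J.Finite) {L : ℝ} (hL : ∀ i ∈ J, lam i ≤ L ^ 2)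
    (hL0 : 0 ≤ L) {w : M} (h : w ∈ clusterSpace u J) :
    normA a (G a b Sh w) ≤ L * ‖j w‖ := by
  obtain ⟨g, hg, rfl, hle⟩ := he.exists_solT_eq hw hJ hL (by positivity) h
  apply le_of_sq_le_sq _ (by positivity)
  rw [hw.G_solT hs, hs.normA_sq, hw.a_solA]
  refine (real_inner_le_norm _ _).trans ?_
  calc _ ≤ (L ^ 2 * ‖j (solT j a b Sh Mh (j g))‖) * ‖j (solT j a b Sh Mh (j g))‖ := by gcongr
    _ = _ := by ring

end IsEigensystem

/-! ### The gap -/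

lemma WellPosed.G_smul (hw : WellPosed j a b Sh Mh) (hs : IsMixedSetting j a b) (c : ℝ) {w : M}
    (h : ∃ g, solT j a b Sh Mh g = w) : G a b Sh (c • w) = c • G a b Sh w := by
  obtain ⟨g, rfl⟩ := h
  rw [← map_smul, hw.G_solT hs, hw.G_solT hs, map_smul]

lemma WellPosed.G_sub (hw : WellPosed j a b Sh Mh) (hs : IsMixedSetting j a b) {v w : M}
    (hv : ∃ g, solT j a b Sh Mh g = v) (h : ∃ g, solT j a b Sh Mh g = w) :
    G a b Sh (v - w) = G a b Sh v - G a b Sh w := by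
  obtain ⟨f, rfl⟩ := hv
  obtain ⟨g, rfl⟩ := h
  rw [← map_sub, hw.G_solT hs, hw.G_solT hs, hw.G_solT hs, map_sub]

lemma mixedDist_nonneg (x v : M) : 0 ≤ mixedDist j a b Sh x v := Real.sqrt_nonneg _

lemma norm_sub_le_mixedDist (x v : M) : ‖j x - j v‖ ≤ mixedDist j a b Sh x v :=
  Real.le_sqrt_of_sq_le (by nlinarith [sq_nonneg (normA a (G a b ⊤ x - G a b Sh v))])

lemma normA_sub_le_mixedDist (x v : M) :
    normA a (G a b ⊤ x - G a b Sh v) ≤ mixedDist j a b Sh x v :=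
  Real.le_sqrt_of_sq_le (by nlinarith [sq_nonneg ‖j x - j v‖])

lemma mixedDist_le_add (x v : M) :
    mixedDist j a b Sh x v ≤ ‖j x - j v‖ + normA a (G a b ⊤ x - G a b Sh v) := by
  have h1 := norm_nonneg (j x - j v)
  have h2 := normA_nonneg (a := a) (G a b ⊤ x - G a b Sh v)
  exact Real.sqrt_le_iff.2 ⟨by positivity, by nlinarith [mul_nonneg h1 h2]⟩

lemma gap_nonneg (W Wh : Submodule ℝ M) : 0 ≤ gap j a b Sh W Wh :=
  Real.iSup_nonneg fun _ => Real.iInf_nonneg fun _ => mixedDist_nonneg _ _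

lemma gap_le {W Wh : Submodule ℝ M} {ε : ℝ} (hε : 0 ≤ ε)
    (h : ∀ x ∈ W, ‖j x‖ = 1 → ∃ v ∈ Wh, mixedDist j a b Sh x v ≤ ε) :
    gap j a b Sh W Wh ≤ ε := by
  refine Real.iSup_le (fun x => ?_) hε
  obtain ⟨v, hv, hle⟩ := h x x.2.1 x.2.2
  exact (ciInf_le ⟨0, by rintro _ ⟨w, rfl⟩; exact mixedDist_nonneg _ _⟩ (⟨v, hv⟩ : Wh)).trans hle

lemma mixedDist_smul (hs : IsMixedSetting j a b) (hw : WellPosed j a b ⊤ ⊤)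
    (hwh : WellPosed j a b Sh Mh) (c : ℝ) {x v : M} (hx : ∃ g, solT j a b ⊤ ⊤ g = x)
    (hv : ∃ g, solT j a b Sh Mh g = v) :
    mixedDist j a b Sh (c • x) (c • v) = |c| * mixedDist j a b Sh x v := by
  unfold mixedDist
  rw [hw.G_smul hs _ hx, hwh.G_smul hs _ hv, ← smul_sub, map_smul, map_smul, ← smul_sub,
    normA_smul, norm_smul, Real.norm_eq_abs, mul_pow, mul_pow, ← mul_add,
    Real.sqrt_mul (sq_nonneg _), Real.sqrt_sq (abs_nonneg c)]

/-- This is how the gap is used: a quantity below all the distances from `x` to `Wh` is below `gap *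
‖j x‖`, by homogeneity. No minimizer is needed. -/
lemma le_gap_mul (hs : IsMixedSetting j a b) (hw : WellPosed j a b ⊤ ⊤)
    (hwh : WellPosed j a b Sh Mh) {W Wh : Submodule ℝ M}
    (hW : ∀ x ∈ W, ∃ g, solT j a b ⊤ ⊤ g = x) (hWh : ∀ x ∈ Wh, ∃ g, solT j a b Sh Mh g = x)
    {L : ℝ} (hL : ∀ x ∈ W, normA a (G a b ⊤ x) ≤ L * ‖j x‖) {x : M} (hx : x ∈ W) {X : ℝ}
    (hX : ∀ v ∈ Wh, X ≤ mixedDist j a b Sh x v) : X ≤ gap j a b Sh W Wh * ‖j x‖ := by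
  have hG0 : G a b Sh (0 : M) = 0 := G_eq hs Sh.zero_mem (by simp)
  rcases eq_or_ne (j x) 0 with h0 | h0
  · have hx0 : x = 0 := hs.embedding_injective (by simpa using h0)
    have hGt : G a b ⊤ (0 : M) = 0 := G_eq hs (Submodule.zero_mem _) (by simp)
    have := hX 0 Wh.zero_mem
    simp only [hx0, mixedDist, hG0, hGt, sub_self, norm_zero, normA_zero] at this
    simpa [hx0] using this
  have hp : 0 < ‖j x‖ := norm_pos_iff.2 h0
  rw [← div_le_iff₀ hp]
  let y : {u : M // u ∈ W ∧ ‖j u‖ = 1} :=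
    ⟨‖j x‖⁻¹ • x, W.smul_mem _ hx, by rw [map_smul, norm_smul]; simp [hp.ne']⟩
  -- An unbounded real supremum would have the default value `0`; the competitor `v = 0` rules this
  -- out.
  have hbdd : BddAbove (Set.range fun u : {u : M // u ∈ W ∧ ‖j u‖ = 1} =>
      ⨅ v : Wh, mixedDist j a b Sh (u : M) (v : M)) := by
    refine ⟨1 + L, ?_⟩
    rintro _ ⟨u, rfl⟩
    refine (ciInf_le ⟨0, by rintro _ ⟨w, rfl⟩; exact mixedDist_nonneg _ _⟩ (0 : Wh)).trans ?_
    refine (mixedDist_le_add _ _).trans ?_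
    have := hL u u.2.1
    rw [u.2.2] at this
    simp only [ZeroMemClass.coe_zero, map_zero, sub_zero, hG0, u.2.2]
    linarith
  refine le_trans ?_ (le_ciSup hbdd y)
  refine le_ciInf fun v => ?_
  have hv := hX (‖j x‖ • (v : M)) (Wh.smul_mem _ v.2)
  have hx' : x = ‖j x‖ • (y : M) := by simp [y, smul_smul, hp.ne']
  have hsc := mixedDist_smul hs hw hwh ‖j x‖ (hW _ y.2.1) (hWh _ v.2)
  rw [← hx', abs_of_pos hp] at hsc
  rw [hsc] at hv
  rwa [div_le_iff₀' hp]

/-! ### The quadratic estimate -/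

section Quadratic

variable {R : ℝ}

/-- By `b_solA` the continuous `T f` can be tested with `A_h w`; the constraint on `σ` lets it
replace `A f` against the discrete function `T_h w`. -/
lemma IsDiscretization.inner_solT_sub (hd : IsDiscretization j a b Sh Mh R)
    (hs : IsMixedSetting j a b) (hw : WellPosed j a b ⊤ ⊤) (hwh : WellPosed j a b Sh Mh)
    {f : H} {w : M} (hwM : w ∈ Mh) {σ : S} (hσ : σ ∈ Sh)
    (hb : ∀ v ∈ Mh, b (solA j a b ⊤ ⊤ f - σ) v = 0) :
    ⟪j (solT j a b ⊤ ⊤ f), j w⟫ - ⟪f, j (solT j a b Sh Mh (j w))⟫ =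
      a (solA j a b Sh Mh (j w)) (solA j a b ⊤ ⊤ f - σ) := by
  have h1 := hd.b_solA hwh hwM (solT j a b ⊤ ⊤ f)
  have h2 := (hw.source f).2.2.1 (solA j a b Sh Mh (j w)) trivial
  have h3 := (hw.source f).2.2.2 (solT j a b Sh Mh (j w)) trivial
  have h4 := (hwh.source (j w)).2.2.1 σ hσ
  have h5 := hb _ (hwh.source (j w)).2.1
  rw [real_inner_comm, map_sub]
  rw [map_sub, sub_apply] at h5
  rw [hs.symm] at h2
  linarith

/-- The functional `b (A x - σ)` is represented by the negative of a vector orthogonal to `Mh`,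
namely the projection error of `x`. So any `q ∈ Mh` may be subtracted from `y`, and a second small
factor appears. -/
lemma IsDiscretization.abs_a_G_le (hd : IsDiscretization j a b Sh Mh R)
    (hs : IsMixedSetting j a b) (hw : WellPosed j a b ⊤ ⊤) {x y p q : M}
    (hy : ∃ g, solT j a b ⊤ ⊤ g = y) (hp : p ∈ Mh) (hq : q ∈ Mh) {σ : S} (hσ : σ ∈ Sh)
    (hb : ∀ v ∈ Mh, b (solA j a b ⊤ ⊤ (j x) - σ) v = 0) :
    |a (G a b ⊤ y) (solA j a b ⊤ ⊤ (j x) - σ)| ≤ ‖j x - j p‖ * ‖j y - j q‖ := by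
  obtain ⟨g, rfl⟩ := hy
  obtain ⟨w, hwM, hbw⟩ := hd.image_subset σ hσ
  have hres : ∀ v, b (solA j a b ⊤ ⊤ (j x) - σ) v = -⟪j x + j w, j v⟫ := fun v => by
    have := (hw.source (j x)).2.2.2 v trivial
    rw [map_sub, sub_apply, this, hbw, inner_add_left]
    ring
  have horth : ∀ v ∈ Mh, ⟪j x + j w, j v⟫ = 0 := fun v hv => by
    have := hb v hv
    rw [hres] at this
    linarith
  have h1 : a (G a b ⊤ (solT j a b ⊤ ⊤ g)) (solA j a b ⊤ ⊤ (j x) - σ) =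
      ⟪j x + j w, j (solT j a b ⊤ ⊤ g) - j q⟫ := by
    have := (hw.source g).2.2.1 (solA j a b ⊤ ⊤ (j x) - σ) trivial
    rw [hres] at this
    rw [hw.G_solT hs, inner_sub_right, horth q hq]
    linarith
  have h2 : ‖j x + j w‖ ≤ ‖j x - j p‖ := by
    have h3 : ‖j x + j w‖ ^ 2 = ⟪j x + j w, j x - j p⟫ := by
      rw [← real_inner_self_eq_norm_sq, inner_add_right, inner_sub_right, horth w hwM, horth p hp]
      ring
    have h4 := real_inner_le_norm (j x + j w) (j x - j p)
    rcases (norm_nonneg (j x + j w)).eq_or_lt with h0 | h0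
    · rw [← h0]; exact norm_nonneg _
    · rw [← h3, pow_two] at h4
      exact le_of_mul_le_mul_left h4 h0
  rw [h1]
  exact (abs_real_inner_le_norm _ _).trans (by gcongr)

variable {W Wh : Submodule ℝ M} {F : M → M} {K Kh Lh D δ κ : ℝ}

/-- The bound `e` on the flux error stays free, so that two different `σ` can be inserted. -/
lemma IsDiscretization.norm_commutator_le (hd : IsDiscretization j a b Sh Mh R)
    (hs : IsMixedSetting j a b) (hw : WellPosed j a b ⊤ ⊤) (hwh : WellPosed j a b Sh Mh)
    (hW : ∀ x ∈ W, ∃ g, solT j a b ⊤ ⊤ g = x) (hWhM : Wh ≤ Mh)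
    (hWhT : ∀ w ∈ Wh, solT j a b Sh Mh (j w) ∈ Wh)
    (hF : ∀ x, F x ∈ Wh) (hFo : ∀ x, ∀ w ∈ Wh, ⟪j x, j w⟫ = ⟪j (F x), j w⟫)
    (hKh : ∀ g : H, normA a (solA j a b Sh Mh g) ≤ Kh * ‖g‖)
    (hδ : 0 ≤ δ) (hD : 0 ≤ D) (hκ : 0 ≤ κ)
    (hδ1 : ∀ x ∈ W, ‖j x - j (F x)‖ ≤ δ * ‖j x‖)
    (hδ2 : ∀ x ∈ W, normA a (G a b ⊤ x - G a b Sh (F x)) ≤ D * δ * ‖j x‖)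
    (hsurj : ∀ w ∈ Wh, ∃ x ∈ W, F x = w ∧ ‖j x‖ ≤ κ * ‖j w‖)
    {x : M} (hx : x ∈ W) {σ : S} (hσ : σ ∈ Sh) {e : ℝ} (he : 0 ≤ e)
    (hb : ∀ v ∈ Mh, b (solA j a b ⊤ ⊤ (j x) - σ) v = 0)
    (hle : normA a (solA j a b ⊤ ⊤ (j x) - σ) ≤ e * ‖j x‖) :
    ‖j (F (solT j a b ⊤ ⊤ (j x))) - j (solT j a b Sh Mh (j (F x)))‖ ≤
      κ * Kh ^ 2 * (D * δ * e + δ ^ 2) * ‖j x‖ := by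
  set w : M := F (solT j a b ⊤ ⊤ (j x)) - solT j a b Sh Mh (j (F x)) with hwdef
  have hwW : w ∈ Wh := Wh.sub_mem (hF _) (hWhT _ (hF _))
  -- Writing `T_h w` as `F y` makes `A_h w` equal to `G_h(F y)`, which is close to `G y`.
  obtain ⟨y, hy, hFy, hyle⟩ := hsurj _ (hWhT _ hwW)
  have h1 : ‖j w‖ ^ 2 =
      a (solA j a b Sh Mh (j w)) (solA j a b ⊤ ⊤ (j x) - σ) := by
    rw [← hd.inner_solT_sub hs hw hwh (hWhM hwW) hσ hb, ← real_inner_self_eq_norm_sq]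
    have e1 := hFo (solT j a b ⊤ ⊤ (j x)) w hwW
    have e2 := hFo x _ (hWhT _ hwW)
    have e3 := hwh.inner_solT_comm hs (j (F x)) (j w)
    have e4 : j w = j (F (solT j a b ⊤ ⊤ (j x))) - j (solT j a b Sh Mh (j (F x))) := by
      rw [hwdef, map_sub]
    rw [e1, e2, ← e3, real_inner_comm _ (j w)]
    nth_rewrite 2 [e4]
    rw [inner_sub_right, real_inner_comm _ (j w)]
  have h2 : ‖j y‖ ≤ κ * (Kh ^ 2 * ‖j w‖) :=
    hyle.trans (by gcongr; exact hwh.norm_solT_le hs hKh _)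
  have h3 : a (solA j a b Sh Mh (j w)) (solA j a b ⊤ ⊤ (j x) - σ) =
      a (G a b ⊤ y) (solA j a b ⊤ ⊤ (j x) - σ) -
        a (G a b ⊤ y - G a b Sh (F y)) (solA j a b ⊤ ⊤ (j x) - σ) := by
    rw [map_sub a, sub_apply, hFy, hwh.G_solT hs]
    ring
  have h4 := hd.abs_a_G_le hs hw (hW y hy) (hWhM (hF x)) (hWhM (hF y)) hσ hb
  have h5 := hs.abs_a_le (G a b ⊤ y - G a b Sh (F y)) (solA j a b ⊤ ⊤ (j x) - σ)
  have h6 : ‖j x - j (F x)‖ * ‖j y - j (F y)‖ ≤ (δ * ‖j x‖) * (δ * ‖j y‖) := by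
    gcongr
    exacts [hδ1 x hx, hδ1 y hy]
  have h7 : normA a (G a b ⊤ y - G a b Sh (F y)) * normA a (solA j a b ⊤ ⊤ (j x) - σ) ≤
      (D * δ * ‖j y‖) * (e * ‖j x‖) := by
    gcongr
    exacts [normA_nonneg _, hδ2 y hy]
  have h8 : ‖j w‖ ^ 2 ≤ (D * δ * e + δ ^ 2) * ‖j x‖ * ‖j y‖ := by
    have := (abs_le.1 h4).2
    have := (abs_le.1 h5).1
    rw [h1, h3]
    nlinarith
  have h9 : ‖j w‖ ^ 2 ≤ (κ * Kh ^ 2 * (D * δ * e + δ ^ 2) * ‖j x‖) * ‖j w‖ :=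
    h8.trans (by
      calc _ ≤ (D * δ * e + δ ^ 2) * ‖j x‖ * (κ * (Kh ^ 2 * ‖j w‖)) := by gcongr
        _ = _ := by ring)
  rw [← map_sub]
  rcases (norm_nonneg (j w)).eq_or_lt with h0 | h0
  · rw [← h0]; positivity
  · rw [pow_two] at h9
    exact le_of_mul_le_mul_right h9 h0

theorem IsDiscretization.norm_commutator_le_sq (hd : IsDiscretization j a b Sh Mh R)
    (hs : IsMixedSetting j a b) (hw : WellPosed j a b ⊤ ⊤) (hwh : WellPosed j a b Sh Mh)
    (hW : ∀ x ∈ W, ∃ g, solT j a b ⊤ ⊤ g = x) (hWT : ∀ x ∈ W, solT j a b ⊤ ⊤ (j x) ∈ W)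
    (hWhM : Wh ≤ Mh) (hWh : ∀ x ∈ Wh, ∃ g, solT j a b Sh Mh g = x)
    (hWhT : ∀ w ∈ Wh, solT j a b Sh Mh (j w) ∈ Wh)
    (hF : ∀ x, F x ∈ Wh) (hFo : ∀ x, ∀ w ∈ Wh, ⟪j x, j w⟫ = ⟪j (F x), j w⟫)
    (hK : ∀ g : H, normA a (solA j a b ⊤ ⊤ g) ≤ K * ‖g‖)
    (hKh : ∀ g : H, normA a (solA j a b Sh Mh g) ≤ Kh * ‖g‖)
    (hLh : ∀ w ∈ Wh, normA a (G a b Sh w) ≤ Lh * ‖j w‖)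
    (hR : 0 ≤ R) (hKh0 : 0 ≤ Kh) (hLh0 : 0 ≤ Lh)
    (hδ : 0 ≤ δ) (hδ' : δ ≤ 1) (hD : 0 ≤ D) (hκ : 0 ≤ κ)
    (hδ1 : ∀ x ∈ W, ‖j x - j (F x)‖ ≤ δ * ‖j x‖)
    (hδ2 : ∀ x ∈ W, normA a (G a b ⊤ x - G a b Sh (F x)) ≤ D * δ * ‖j x‖)
    (hsurj : ∀ w ∈ Wh, ∃ x ∈ W, F x = w ∧ ‖j x‖ ≤ κ * ‖j w‖) {x : M} (hx : x ∈ W) :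
    ‖j (F (solT j a b ⊤ ⊤ (j x))) - j (solT j a b Sh Mh (j (F x)))‖ ≤
      κ * Kh ^ 2 * (D * (D * K ^ 2 + Lh * (κ * Kh ^ 2 * (D * R + 1)) + Kh) + 1) * δ ^ 2 *
        ‖j x‖ := by
  set E := κ * Kh ^ 2 * (D * R + 1) with hE
  have hE0 : 0 ≤ E := by positivity
  set e := D * K ^ 2 + Lh * E + Kh with hedef
  have he0 : 0 ≤ e := by positivity
  obtain ⟨σ, hσ, hb, hle⟩ := hd.fortid (j x) _ _ (hw.source (j x))
  -- First pass, with the Fortin interpolant: only first order in `δ`.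
  have h1 : ‖j (F (solT j a b ⊤ ⊤ (j x))) - j (solT j a b Sh Mh (j (F x)))‖ ≤ E * δ * ‖j x‖ := by
    refine (hd.norm_commutator_le hs hw hwh hW hWhM hWhT hF hFo hKh hδ hD hκ hδ1 hδ2 hsurj hx hσ
      hR hb hle).trans ?_
    have : D * δ * R + δ ^ 2 ≤ (D * R + 1) * δ := by nlinarith
    calc _ ≤ κ * Kh ^ 2 * ((D * R + 1) * δ) * ‖j x‖ := by gcongr
      _ = _ := by rw [hE]; ring
  -- Path `A x`, `G_h(F T x)`, `A_h(F x)`, `A_h x`: the three steps cost the gap at `T x`, the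
  -- first-order commutator and the projection error of `x`.
  have h2 : normA a (solA j a b ⊤ ⊤ (j x) - solA j a b Sh Mh (j x)) ≤ (e * δ) * ‖j x‖ := by
    have h3 : normA a (solA j a b ⊤ ⊤ (j x) - G a b Sh (F (solT j a b ⊤ ⊤ (j x)))) ≤
        D * δ * (K ^ 2 * ‖j x‖) := by
      rw [← hw.G_solT hs]
      exact (hδ2 _ (hWT x hx)).trans (by gcongr; exact hw.norm_solT_le hs hK _)
    have h4 : normA a (G a b Sh (F (solT j a b ⊤ ⊤ (j x))) - solA j a b Sh Mh (j (F x))) ≤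
        Lh * (E * δ * ‖j x‖) := by
      rw [← hwh.G_solT hs, ← hwh.G_sub hs (hWh _ (hF _)) ⟨_, rfl⟩]
      refine (hLh _ (Wh.sub_mem (hF _) (hWhT _ (hF _)))).trans ?_
      rw [map_sub]
      gcongr
    have h5 : normA a (solA j a b Sh Mh (j (F x)) - solA j a b Sh Mh (j x)) ≤
        Kh * (δ * ‖j x‖) := by
      rw [← map_sub]
      refine (hKh _).trans ?_
      rw [norm_sub_rev]
      gcongr
      exact hδ1 x hx
    have h6 := hs.normA_sub_le (solA j a b ⊤ ⊤ (j x)) (G a b Sh (F (solT j a b ⊤ ⊤ (j x))))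
      (solA j a b Sh Mh (j x))
    have h7 := hs.normA_sub_le (G a b Sh (F (solT j a b ⊤ ⊤ (j x))))
      (solA j a b Sh Mh (j (F x))) (solA j a b Sh Mh (j x))
    rw [hedef]
    linarith
  -- Second pass, with `σ = A_h x`: the flux error is now `e * δ`, so both terms are quadratic.
  refine (hd.norm_commutator_le hs hw hwh hW hWhM hWhT hF hFo hKh hδ hD hκ hδ1 hδ2 hsurj hx
    (hwh.source (j x)).1 (by positivity) (fun v hv => ?_) h2).trans (le_of_eq (by ring))
  rw [map_sub, sub_apply, (hw.source (j x)).2.2.2 v trivial, (hwh.source (j x)).2.2.2 v hv, sub_self]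

end Quadratic

/-! ### Bijectivity of the projection and the bound in the operator norm -/

lemma exists_projF_eq (j : M →L[ℝ] H) (Wh : Submodule ℝ M) [FiniteDimensional ℝ Wh] :
    ∃ F : M → M, (∀ x, F x ∈ Wh) ∧ (∀ x, ∀ w ∈ Wh, ⟪j x, j w⟫ = ⟪j (F x), j w⟫) ∧
      ∀ x, j (F x) = (inH j Wh).orthogonalProjectionOnto (j x) := by
  have h : ∀ x : M, ∃ y ∈ Wh, j y = (inH j Wh).orthogonalProjectionOnto (j x) := fun x =>
    ((inH j Wh).orthogonalProjectionOnto (j x)).2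
  choose F hF hFj using h
  refine ⟨F, hF, fun x w hw => ?_, hFj⟩
  rw [hFj]
  exact ((inH j Wh).inner_orthogonalProjectionOnto_eq_of_mem_right ⟨j w, w, hw, rfl⟩ (j x)).symm

section Projection

variable {W Wh : Submodule ℝ M} {F : M → M}

lemma norm_sub_sq_of_inner_eq (hF : ∀ x, F x ∈ Wh)
    (hFo : ∀ x, ∀ w ∈ Wh, ⟪j x, j w⟫ = ⟪j (F x), j w⟫) (x : M) {v : M} (hv : v ∈ Wh) :
    ‖j x - j v‖ ^ 2 = ‖j x - j (F x)‖ ^ 2 + ‖j (F x) - j v‖ ^ 2 := by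
  have h : ⟪j x - j (F x), j (F x) - j v⟫ = 0 := by
    rw [← map_sub j (F x), inner_sub_left, hFo x _ (Wh.sub_mem (hF x) hv), sub_self]
  have h2 := norm_add_sq_real (j x - j (F x)) (j (F x) - j v)
  rw [h] at h2
  simpa using h2

lemma norm_sub_le_of_inner_eq (hF : ∀ x, F x ∈ Wh)
    (hFo : ∀ x, ∀ w ∈ Wh, ⟪j x, j w⟫ = ⟪j (F x), j w⟫) (x : M) {v : M} (hv : v ∈ Wh) :
    ‖j x - j (F x)‖ ≤ ‖j x - j v‖ ∧ ‖j (F x) - j v‖ ≤ ‖j x - j v‖ := by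
  have h := norm_sub_sq_of_inner_eq hF hFo x hv
  constructor <;> refine le_of_sq_le_sq ?_ (norm_nonneg _) <;>
    nlinarith [sq_nonneg ‖j x - j (F x)‖, sq_nonneg ‖j (F x) - j v‖]

lemma finrank_inH (hj : Function.Injective j) (W : Submodule ℝ M) :
    Module.finrank ℝ (inH j W) = Module.finrank ℝ W :=
  (Submodule.equivMapOfInjective (j : M →ₗ[ℝ] H) hj W).finrank_eq.symm

lemma bijective_projF (hj : Function.Injective j) [FiniteDimensional ℝ W] [FiniteDimensional ℝ Wh]
    (hrank : Module.finrank ℝ Wh ≤ Module.finrank ℝ W)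
    (hFj : ∀ x, j (F x) = (inH j Wh).orthogonalProjectionOnto (j x)) {κ : ℝ}
    (hκ : ∀ x ∈ W, ‖j x‖ ≤ κ * ‖j (F x)‖) :
    Function.Bijective (projF (inH j W) (inH j Wh)) := by
  have hinj : Function.Injective (projF (inH j W) (inH j Wh)) := by
    rw [← LinearMap.ker_eq_bot, LinearMap.ker_eq_bot']
    rintro ⟨_, x, hx, rfl⟩ h0
    have h1 : j (F x) = 0 := by
      rw [hFj]
      exact congrArg Subtype.val h0
    have h2 := hκ x hx
    rw [h1, norm_zero, mul_zero] at h2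
    ext
    simpa using h2
  refine ⟨hinj, (LinearMap.injective_iff_surjective_of_finrank_eq_finrank ?_).1 hinj⟩
  refine le_antisymm (LinearMap.finrank_le_finrank_of_injective hinj) ?_
  rwa [finrank_inH hj, finrank_inH hj]

/-- Applying `F` to the difference of the two operators on `W` gives the commutator; `κ` bounds the
inverse of `F`. -/
lemma hatEstimate_of_norm_commutator_le (hj : Function.Injective j) [FiniteDimensional ℝ W]
    [FiniteDimensional ℝ Wh] {T Th : H →ₗ[ℝ] M} (hWT : ∀ x ∈ W, T (j x) ∈ W)
    (hWhT : ∀ x ∈ Wh, Th (j x) ∈ Wh)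
    (hrank : Module.finrank ℝ Wh ≤ Module.finrank ℝ W)
    (hFj : ∀ x, j (F x) = (inH j Wh).orthogonalProjectionOnto (j x)) {κ : ℝ} (hκ0 : 0 ≤ κ)
    (hκ : ∀ x ∈ W, ‖j x‖ ≤ κ * ‖j (F x)‖) {ε : ℝ} (hε : 0 ≤ ε)
    (h : ∀ x ∈ W, ‖j (F (T (j x))) - j (Th (j (F x)))‖ ≤ ε * ‖j x‖) :
    HatEstimate ((j : M →ₗ[ℝ] H) ∘ₗ T) ((j : M →ₗ[ℝ] H) ∘ₗ Th) (inH j W) (inH j Wh) (κ * ε) := by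
  have hT : ∀ x ∈ inH j W, ((j : M →ₗ[ℝ] H) ∘ₗ T) x ∈ inH j W := by
    rintro _ ⟨x, hx, rfl⟩
    exact ⟨_, hWT x hx, rfl⟩
  have hTh : ∀ x ∈ inH j Wh, ((j : M →ₗ[ℝ] H) ∘ₗ Th) x ∈ inH j Wh := by
    rintro _ ⟨x, hx, rfl⟩
    exact ⟨_, hWhT x hx, rfl⟩
  have hbij := bijective_projF hj hrank hFj hκ
  refine ⟨hT, hTh, hbij, ContinuousLinearMap.opNorm_le_bound _ (by positivity) ?_⟩
  intro x
  set z : inH j W := (((j : M →ₗ[ℝ] H) ∘ₗ T).restrict hT -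
    hatTh ((j : M →ₗ[ℝ] H) ∘ₗ Th) (inH j W) (inH j Wh) hTh hbij) x with hz
  change ‖z‖ ≤ _
  have h1 : projF (inH j W) (inH j Wh) z =
      projF (inH j W) (inH j Wh) (((j : M →ₗ[ℝ] H) ∘ₗ T).restrict hT x) -
        ((j : M →ₗ[ℝ] H) ∘ₗ Th).restrict hTh (projF (inH j W) (inH j Wh) x) := by
    rw [hz, LinearMap.sub_apply, map_sub]
    congr 1
    exact LinearEquiv.apply_symm_apply (LinearEquiv.ofBijective _ hbij) _
  have h2 : ‖z‖ ≤ κ * ‖projF (inH j W) (inH j Wh) z‖ := by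
    obtain ⟨y, hy, hyz⟩ := z.2
    have hyz' : j y = z := hyz
    have := hκ y hy
    rw [hFj, hyz'] at this
    exact this
  obtain ⟨y, hy, hyx⟩ := x.2
  have hyx' : j y = x := hyx
  have h3 : ‖projF (inH j W) (inH j Wh) z‖ ≤ ε * ‖x‖ := by
    have h4 := h y hy
    rw [hFj (T _), hFj y, hyx'] at h4
    rw [h1]
    exact h4
  calc ‖z‖ ≤ κ * ‖projF (inH j W) (inH j Wh) z‖ := h2
    _ ≤ κ * (ε * ‖x‖) := by gcongr
    _ = κ * ε * ‖x‖ := by ring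

end Projection

/-! ### The estimate under a bound for the gap -/

lemma IsDiscretization.mono {R R' : ℝ} (hd : IsDiscretization j a b Sh Mh R) (h : R ≤ R') :
    IsDiscretization j a b Sh Mh R' where
  finite_S := hd.finite_S
  finite_M := hd.finite_M
  image_subset := hd.image_subset
  subset_image := hd.subset_image
  fortid g σ u hg := by
    obtain ⟨σh, h1, h2, h3⟩ := hd.fortid g σ u hg
    exact ⟨σh, h1, h2, h3.trans (by gcongr)⟩
  strong_approx g σ u hg := (hd.strong_approx g σ u hg).trans (by gcongr)

/-- A discrete eigenvalue whose eigenfunction is the projection of a continuous function `x` is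
controlled by the distance from `x` to the discrete cluster. -/
lemma IsEigensystem.lam_le_of_mixedDist_lt {I : Type*} [Preorder I] {lamh : I → ℝ} {sigh : I → S}
    {uh : I → M} {J : Set I} (heh : IsEigensystem j a b Sh Mh lamh sigh uh)
    (hs : IsMixedSetting j a b) (hwh : WellPosed j a b Sh Mh) {F : M → M}
    (hJ : J.Finite)
    (hF : ∀ x, F x ∈ clusterSpace uh J)
    (hFo : ∀ x, ∀ w ∈ clusterSpace uh J, ⟪j x, j w⟫ = ⟪j (F x), j w⟫) {θ L : ℝ} (hθ : θ < 1)
    {x v : M} {k : I} (hx : F x = uh k) (hv : v ∈ clusterSpace uh J)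
    (hdist : mixedDist j a b Sh x v ≤ θ * ‖j x‖) (hL : normA a (G a b ⊤ x) ≤ L * ‖j x‖) :
    lamh k ≤ ((L + 1) * ‖j x‖ / (1 - θ)) ^ 2 := by
  have huk : ‖j (uh k)‖ = 1 := heh.orthonormal.norm_eq_one k
  have hθ' : 0 < 1 - θ := by linarith
  have hpos := heh.pos k
  have hd0 := norm_sub_le_mixedDist (j := j) (a := a) (b := b) (Sh := Sh) x v
  have hd1 := normA_sub_le_mixedDist (j := j) (a := a) (b := b) (Sh := Sh) x v
  have h1 := norm_sub_sq_of_inner_eq hF hFo x hv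
  have h2 := norm_sub_sq_of_inner_eq hF hFo x (Submodule.zero_mem _)
  simp only [map_zero, sub_zero, hx, huk] at h1 h2
  have hx0 : 0 ≤ θ * ‖j x‖ := (mixedDist_nonneg _ _).trans hdist
  have hx1 : 1 ≤ ‖j x‖ := by
    by_contra hc
    nlinarith [norm_nonneg (j x), sq_nonneg ‖j x - j (uh k)‖]
  have hθ0 : 0 ≤ θ := by
    by_contra hc
    nlinarith
  -- Pythagoras: the square is at most `θ²‖x‖² - (‖x‖² - 1)`, and `‖x‖ ≥ 1`.
  have h3 : ‖j (uh k) - j v‖ ≤ θ := by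
    refine le_of_sq_le_sq ?_ hθ0
    have h4 : ‖j x - j v‖ ^ 2 ≤ (θ * ‖j x‖) ^ 2 := by
      gcongr; exact hd0.trans hdist
    have : θ ^ 2 ≤ 1 := by nlinarith
    have : 0 ≤ (‖j x‖ ^ 2 - 1) * (1 - θ ^ 2) := mul_nonneg (by nlinarith) (by linarith)
    nlinarith
  have h4 : 1 - θ ≤ ⟪j (uh k), j v⟫ := by
    have h5 : ⟪j (uh k), j v⟫ = 1 - ⟪j (uh k), j (uh k) - j v⟫ := by
      rw [inner_sub_right, real_inner_self_eq_norm_sq, huk]; ring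
    have h6 := real_inner_le_norm (j (uh k)) (j (uh k) - j v)
    rw [huk, one_mul] at h6
    linarith
  have h7 : normA a (G a b Sh v) ≤ (L + 1) * ‖j x‖ := by
    have := hs.normA_le_add_sub (G a b Sh v) (G a b ⊤ x)
    rw [normA_sub_comm] at this
    nlinarith
  obtain ⟨e1, e2, e3, e4⟩ := heh.eigen k
  have h8 : normA a (sigh k) ^ 2 = lamh k := by
    rw [hs.normA_sq, heh.a_sig e2 e3, real_inner_self_eq_norm_sq, huk]; ring
  obtain ⟨g, -, hg, -⟩ := heh.exists_solT_eq hwh hJ (L := ∑ i ∈ hJ.toFinset, lamh i)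
    (fun i hi => Finset.single_le_sum (f := lamh) (fun i _ => (heh.pos i).le)
      (hJ.mem_toFinset.2 hi)) (Finset.sum_nonneg fun i _ => (heh.pos i).le) hv
  have h9 : a (G a b Sh v) (sigh k) = lamh k * ⟪j (uh k), j v⟫ := by
    rw [← hg, hwh.G_solT hs]
    exact heh.a_sig (hwh.source _).2.1 (hwh.source _).2.2.1
  have h10 := hs.a_le (G a b Sh v) (sigh k)
  have h11 : 0 < normA a (sigh k) := by
    refine lt_of_le_of_ne (normA_nonneg _) fun h => ?_
    rw [← h] at h8
    linarith [zero_pow (M₀ := ℝ) two_ne_zero]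
  -- Testing `G_h v` with `sigh k` produces the full `lamh k`, while Cauchy–Schwarz gives back only
  -- its square root.
  have h12 : normA a (sigh k) * (1 - θ) ≤ (L + 1) * ‖j x‖ := by
    have h13 : normA a (sigh k) * (normA a (sigh k) * (1 - θ)) ≤
        normA a (sigh k) * ((L + 1) * ‖j x‖) := by
      calc normA a (sigh k) * (normA a (sigh k) * (1 - θ)) = lamh k * (1 - θ) := by rw [← h8]; ring
        _ ≤ lamh k * ⟪j (uh k), j v⟫ := by gcongr
        _ ≤ normA a (G a b Sh v) * normA a (sigh k) := by rw [← h9]; exact h10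
        _ ≤ ((L + 1) * ‖j x‖) * normA a (sigh k) := by gcongr
        _ = _ := by ring
    exact le_of_mul_le_mul_left h13 h11
  rw [← h8]
  gcongr
  rwa [le_div_iff₀ hθ']

/-- The estimate of the operators on the clusters, with a constant that depends only on bounds for
the data of the continuous problem, on `R` and on `θ`. -/
theorem exists_hatEstimate (hs : IsMixedSetting j a b) (hw : WellPosed j a b ⊤ ⊤)
    {K : ℝ} (hK0 : 0 ≤ K) (hK : ∀ g : H, normA a (solA j a b ⊤ ⊤ g) ≤ K * ‖g‖)
    {lam : ℕ → ℝ} {sig : ℕ → S} {u : ℕ → M} (he : IsEigensystem j a b ⊤ ⊤ lam sig u)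
    (n N : ℕ) {R θ : ℝ} (hR : 0 ≤ R) (hθ0 : 0 ≤ θ) (hθ : θ < 1) :
    ∃ C : ℝ, ∀ (Sh : Submodule ℝ S) (Mh : Submodule ℝ M)
        (lamh : Fin (Module.finrank ℝ Mh) → ℝ) (sigh : Fin (Module.finrank ℝ Mh) → S)
        (uh : Fin (Module.finrank ℝ Mh) → M),
        IsDiscretization j a b Sh Mh R →
        IsEigensystem j a b Sh Mh lamh sigh uh →
        gap j a b Sh (clusterSpace u (Set.Ico n (n + N)))
          (clusterSpace uh {k | (k : ℕ) ∈ Set.Ico n (n + N)}) ≤ θ →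
        HatEstimate (solTH j a b ⊤ ⊤) (solTH j a b Sh Mh)
          (inH j (clusterSpace u (Set.Ico n (n + N))))
          (inH j (clusterSpace uh {k | (k : ℕ) ∈ Set.Ico n (n + N)}))
          (C * gap j a b Sh (clusterSpace u (Set.Ico n (n + N)))
            (clusterSpace uh {k | (k : ℕ) ∈ Set.Ico n (n + N)}) ^ 2) := by
  -- Indices start at zero, so `n + N` is the first one past the cluster; it gives an upper bound
  -- even for `N = 0`.
  set L := Real.sqrt (lam (n + N)) with hLdef
  have hL0 : 0 ≤ L := Real.sqrt_nonneg _
  have hL2 : L ^ 2 = lam (n + N) := Real.sq_sqrt (he.pos _).le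
  set κ := (1 - θ)⁻¹ with hκdef
  have hθ1 : 0 < 1 - θ := by linarith
  have hκ0 : 0 ≤ κ := inv_nonneg.2 hθ1.le
  -- Strictly larger than `θ`, so that a competitor exists without attainment of the infimum.
  set θ' := (1 + θ) / 2 with hθ'
  have hθ'1 : 0 < 1 - θ' := by rw [hθ']; linarith
  set Lh := (L + 1) * κ / (1 - θ') with hLh
  have hLh0 : 0 ≤ Lh := by positivity
  -- Cost of passing from an arbitrary `v ∈ Wh` to `F x` in the flux part of the distance.
  set D := 1 + Lh with hDdef
  have hD0 : 0 ≤ D := by positivity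
  set Kh := K + R with hKhdef
  have hKh0 : 0 ≤ Kh := by positivity
  refine ⟨κ * (κ * Kh ^ 2 * (D * (D * K ^ 2 + Lh * (κ * Kh ^ 2 * (D * R + 1)) + Kh) + 1)), ?_⟩
  intro Sh Mh lamh sigh uh hd heh hgap
  have hwh := hd.wellPosed hs
  set J : Set ℕ := Set.Ico n (n + N) with hJ
  have hJf : J.Finite := Set.finite_Ico _ _
  set Jh : Set (Fin (Module.finrank ℝ Mh)) := {k | (k : ℕ) ∈ J} with hJh
  have hJhf : Jh.Finite := Set.toFinite _
  set W := clusterSpace u J with hWdef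
  set Wh := clusterSpace uh Jh with hWhdef
  set δ := gap j a b Sh W Wh with hδ
  have hδ0 : 0 ≤ δ := gap_nonneg _ _
  have hWT : ∀ x ∈ W, solT j a b ⊤ ⊤ (j x) ∈ W := fun x hx => he.solT_mem hw hx
  have hWhT : ∀ x ∈ Wh, solT j a b Sh Mh (j x) ∈ Wh := fun x hx => heh.solT_mem hwh hx
  have hlam : ∀ i ∈ J, lam i ≤ L ^ 2 := fun i hi => by
    rw [hL2]
    exact he.mono hi.2.le
  have hW : ∀ x ∈ W, ∃ g, solT j a b ⊤ ⊤ g = x := fun x hx => by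
    obtain ⟨g, -, hg, -⟩ := he.exists_solT_eq hw hJf hlam (by positivity) hx
    exact ⟨_, hg⟩
  have hWh : ∀ x ∈ Wh, ∃ g, solT j a b Sh Mh g = x := fun x hx => by
    obtain ⟨g, -, hg, -⟩ := heh.exists_solT_eq hwh hJhf (L := ∑ i ∈ hJhf.toFinset, lamh i)
      (fun i hi => Finset.single_le_sum (f := lamh) (fun i _ => (heh.pos i).le)
        (hJhf.mem_toFinset.2 hi)) (Finset.sum_nonneg fun i _ => (heh.pos i).le) hx
    exact ⟨_, hg⟩
  have hWhM : Wh ≤ Mh := clusterSpace_le fun k _ => (heh.eigen k).2.1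
  have hL : ∀ x ∈ W, normA a (G a b ⊤ x) ≤ L * ‖j x‖ := fun x hx =>
    he.normA_G_le hw hs hJf hlam hL0 hx
  have hgapX : ∀ x ∈ W, ∀ X : ℝ, (∀ v ∈ Wh, X ≤ mixedDist j a b Sh x v) → X ≤ δ * ‖j x‖ :=
    fun x hx X hX => le_gap_mul hs hw hwh hW hWh hL hx hX
  obtain ⟨F, hF, hFo, hFj⟩ := exists_projF_eq j Wh
  have hδ1 : ∀ x ∈ W, ‖j x - j (F x)‖ ≤ δ * ‖j x‖ := fun x hx => hgapX x hx _ fun v hv =>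
    (norm_sub_le_of_inner_eq hF hFo x hv).1.trans (norm_sub_le_mixedDist x v)
  have hκ : ∀ x ∈ W, ‖j x‖ ≤ κ * ‖j (F x)‖ := fun x hx => by
    have h1 := hδ1 x hx
    have h2 := norm_sub_norm_le (j x) (j (F x))
    have h3 : δ * ‖j x‖ ≤ θ * ‖j x‖ := by gcongr
    rw [hκdef, inv_mul_eq_div, le_div_iff₀ hθ1]
    linarith
  -- `Wh` has smaller dimension if `Mh` is too small to hold the cluster; injectivity of `F`
  -- excludes this.
  have hrank : Module.finrank ℝ Wh ≤ Module.finrank ℝ W := by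
    rw [finrank_clusterSpace he.orthonormal, finrank_clusterSpace heh.orthonormal]
    exact Set.ncard_le_ncard_of_injOn (fun k => (k : ℕ)) (fun k hk => hk)
      (Fin.val_injective.injOn) hJf
  have hbij := bijective_projF hs.embedding_injective hrank hFj hκ
  have hsurj : ∀ w ∈ Wh, ∃ x ∈ W, F x = w ∧ ‖j x‖ ≤ κ * ‖j w‖ := fun w hww => by
    obtain ⟨⟨_, x, hx, rfl⟩, h⟩ := hbij.2 ⟨j w, w, hww, rfl⟩
    have hFx : F x = w := hs.embedding_injective (by rw [hFj]; exact congrArg Subtype.val h)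
    exact ⟨x, hx, hFx, hFx ▸ hκ x hx⟩
  have hlamh : ∀ k ∈ Jh, lamh k ≤ Lh ^ 2 := fun k hk => by
    obtain ⟨x, hx, hxk, hxle⟩ := hsurj _ (mem_clusterSpace uh hk)
    have huk : ‖j (uh k)‖ = 1 := heh.orthonormal.norm_eq_one k
    have hxpos : 0 < ‖j x‖ := norm_pos_iff.2 fun h0 => by
      have : x = 0 := hs.embedding_injective (by simpa using h0)
      have h2 := norm_sub_sq_of_inner_eq hF hFo x (Submodule.zero_mem _)
      rw [hxk] at h2
      simp only [map_zero, sub_zero, h0, huk, norm_zero] at h2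
      nlinarith [sq_nonneg ‖(0 : H) - j (uh k)‖]
    obtain ⟨v, hv, hlt⟩ : ∃ v ∈ Wh, mixedDist j a b Sh x v ≤ θ' * ‖j x‖ := by
      by_contra! hc
      have := hgapX x hx _ fun v hv => (hc v hv).le
      have h5 : θ' ≤ δ := le_of_mul_le_mul_right this hxpos
      rw [hθ'] at h5
      linarith
    refine (heh.lam_le_of_mixedDist_lt hs hwh hJhf hF hFo (by linarith) hxk hv hlt
      (hL x hx)).trans ?_
    rw [huk, mul_one] at hxle
    rw [hLh]
    gcongr
  have hGh : ∀ w ∈ Wh, normA a (G a b Sh w) ≤ Lh * ‖j w‖ := fun w hww =>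
    heh.normA_G_le hwh hs hJhf hlamh hLh0 hww
  have hδ2 : ∀ x ∈ W, normA a (G a b ⊤ x - G a b Sh (F x)) ≤ D * δ * ‖j x‖ := fun x hx => by
    have h1 : normA a (G a b ⊤ x - G a b Sh (F x)) / D ≤ δ * ‖j x‖ := by
      refine hgapX x hx _ fun v hv => ?_
      rw [div_le_iff₀' (by positivity)]
      refine (hs.normA_sub_le _ (G a b Sh v) _).trans ?_
      have h2 := normA_sub_le_mixedDist (j := j) (a := a) (b := b) (Sh := Sh) x v
      have h3 := norm_sub_le_mixedDist (j := j) (a := a) (b := b) (Sh := Sh) x v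
      rw [← hwh.G_sub hs (hWh v hv) (hWh _ (hF x))]
      have h4 := hGh _ (Wh.sub_mem hv (hF x))
      rw [map_sub, norm_sub_rev] at h4
      have h5 := (norm_sub_le_of_inner_eq hF hFo x hv).2
      have h6 : Lh * ‖j (F x) - j v‖ ≤ Lh * mixedDist j a b Sh x v := by
        gcongr; exact h5.trans h3
      rw [hDdef]
      linarith
    rw [div_le_iff₀' (by positivity)] at h1
    linarith
  have hmain := fun x (hx : x ∈ W) => hd.norm_commutator_le_sq hs hw hwh hW hWT hWhM hWh hWhT hF
    hFo hK (hd.normA_solA_le hs hw hwh hK) hGh hR hKh0 hLh0 hδ0 (hgap.trans hθ.le) hD0 hκ0 hδ1 hδ2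
    hsurj hx
  have := hatEstimate_of_norm_commutator_le hs.embedding_injective hWT hWhT hrank hFj hκ0 hκ
    (by positivity) hmain
  rw [← mul_assoc] at this
  exact this

/-! ### Convergence of the discrete solution operators -/

section Convergence

variable {ρ K : ℝ}

/-- The flux error is `a`-orthogonal to the discrete kernel, since that lies in the kernel of `b`;
so it is at most the Fortin error. -/
lemma IsDiscretization.normA_solA_sub_le (hd : IsDiscretization j a b Sh Mh ρ)
    (hs : IsMixedSetting j a b) (hw : WellPosed j a b ⊤ ⊤) (hwh : WellPosed j a b Sh Mh) (g : H) :
    normA a (solA j a b ⊤ ⊤ g - solA j a b Sh Mh g) ≤ ρ * ‖g‖ := by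
  obtain ⟨σ, hσ, hb, hle⟩ := hd.fortid g _ _ (hw.source g)
  set e := solA j a b ⊤ ⊤ g - solA j a b Sh Mh g with he
  have hm : solA j a b Sh Mh g - σ ∈ Sh := Sh.sub_mem (hwh.source g).1 hσ
  obtain ⟨h1, h2⟩ := hd.a_solA_sub_eq_zero hwh g hm (fun v hv => by
    have h1 := (hwh.source g).2.2.2 v hv
    have h2 := (hw.source g).2.2.2 v trivial
    have h3 := hb v hv
    simp only [map_sub, sub_apply] at h3 ⊢
    linarith) (solT j a b ⊤ ⊤ g)
  have h3 := (hw.source g).2.2.1 (solA j a b Sh Mh g - σ) trivial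
  have h4 : a e (solA j a b Sh Mh g - σ) = 0 := by
    rw [he, map_sub a, sub_apply]
    linarith
  have h5 : normA a e ^ 2 ≤ normA a e * normA a (solA j a b ⊤ ⊤ g - σ) := by
    have h6 : solA j a b ⊤ ⊤ g - σ = e + (solA j a b Sh Mh g - σ) := by rw [he]; abel
    refine le_trans (le_of_eq ?_) (hs.a_le _ _)
    rw [h6, map_add, h4, add_zero, hs.normA_sq]
  rcases (normA_nonneg (a := a) e).eq_or_lt with h0 | h0
  · rw [← h0]
    exact (normA_nonneg _).trans hle
  · rw [pow_two] at h5
    exact (le_of_mul_le_mul_left h5 h0).trans hle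

/-- Strong approximability controls the distance to `Mh`. The remaining part `y ∈ Mh` satisfies
`‖y‖² = a(A g - A_h g, A_h y)`. -/
lemma IsDiscretization.norm_solT_sub_le (hd : IsDiscretization j a b Sh Mh ρ)
    (hs : IsMixedSetting j a b) (hw : WellPosed j a b ⊤ ⊤) (hwh : WellPosed j a b Sh Mh)
    (hKρ : 0 ≤ K + ρ) (hK : ∀ g : H, normA a (solA j a b ⊤ ⊤ g) ≤ K * ‖g‖) (g : H) :
    ‖j (solT j a b ⊤ ⊤ g) - j (solT j a b Sh Mh g)‖ ≤ ρ * (1 + (K + ρ)) * ‖g‖ := by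
  have := hd.finite_M
  obtain ⟨F, hF, hFo, -⟩ := exists_projF_eq j Mh
  have h1 : ‖j (solT j a b ⊤ ⊤ g) - j (F (solT j a b ⊤ ⊤ g))‖ ≤ ρ * ‖g‖ :=
    le_trans (le_ciInf fun v => (norm_sub_le_of_inner_eq hF hFo _ v.2).1)
      (hd.strong_approx g _ _ (hw.source g))
  set y := F (solT j a b ⊤ ⊤ g) - solT j a b Sh Mh g with hy
  have hyM : y ∈ Mh := Mh.sub_mem (hF _) (hwh.source g).2.1
  have h2 : ‖j y‖ ^ 2 =
      a (solA j a b ⊤ ⊤ g - solA j a b Sh Mh g) (solA j a b Sh Mh (j y)) := by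
    have e1 := hd.b_solA hwh hyM (solT j a b ⊤ ⊤ g)
    have e2 := (hw.source g).2.2.1 (solA j a b Sh Mh (j y)) trivial
    have e3 := hwh.a_solA g (j y)
    have e4 := hFo (solT j a b ⊤ ⊤ g) y hyM
    have e5 : j y = j (F (solT j a b ⊤ ⊤ g)) - j (solT j a b Sh Mh g) := by rw [hy, map_sub]
    have e6 : ‖j y‖ ^ 2 = ⟪j (F (solT j a b ⊤ ⊤ g)), j y⟫ - ⟪j (solT j a b Sh Mh g), j y⟫ := by
      rw [← inner_sub_left, ← e5, real_inner_self_eq_norm_sq]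
    rw [e6, ← e4, map_sub a, sub_apply, e3, real_inner_comm (j y), real_inner_comm (j y)]
    linarith
  have h3 : ‖j y‖ ≤ ρ * (K + ρ) * ‖g‖ := by
    have h4 : ‖j y‖ ^ 2 ≤ (ρ * (K + ρ) * ‖g‖) * ‖j y‖ := by
      rw [h2]
      refine (hs.a_le _ _).trans ?_
      calc _ ≤ (ρ * ‖g‖) * ((K + ρ) * ‖j y‖) := by
            have := hd.normA_solA_sub_le hs hw hwh g
            exact mul_le_mul this (hd.normA_solA_le hs hw hwh hK _) (normA_nonneg _)
              ((normA_nonneg _).trans this)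
        _ = _ := by ring
    rcases (norm_nonneg (j y)).eq_or_lt with h0 | h0
    · rw [← h0]
      have := (norm_nonneg _).trans h1
      nlinarith [mul_nonneg this hKρ]
    · rw [pow_two] at h4
      exact le_of_mul_le_mul_right h4 h0
  have h5 := norm_add_le (j (solT j a b ⊤ ⊤ g) - j (F (solT j a b ⊤ ⊤ g))) (j y)
  have h6 : j (solT j a b ⊤ ⊤ g) - j (F (solT j a b ⊤ ⊤ g)) + j y =
      j (solT j a b ⊤ ⊤ g) - j (solT j a b Sh Mh g) := by
    rw [hy, map_sub]; abel
  rw [h6] at h5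
  linarith

end Convergence

/-! ### Comparison of the eigenvalues -/

namespace IsEigensystem

variable {I : Type*} [Preorder I] {lam : I → ℝ} {sig : I → S} {u : I → M} {J : Set I}

lemma inner_solT (he : IsEigensystem j a b Sh Mh lam sig u) (hw : WellPosed j a b Sh Mh)
    (hs : IsMixedSetting j a b) (i : I) (x : H) :
    ⟪j (u i), j (solT j a b Sh Mh x)⟫ = (lam i)⁻¹ * ⟪j (u i), x⟫ := by
  rw [hw.inner_solT_comm hs, he.solT_apply hw, map_smul, real_inner_smul_right, real_inner_comm]

lemma le_inner_solT (he : IsEigensystem j a b Sh Mh lam sig u) (hw : WellPosed j a b Sh Mh)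
    (hs : IsMixedSetting j a b) (hJ : J.Finite) {L : ℝ} (hL : ∀ i ∈ J, lam i ≤ L)
    {w : M} (h : w ∈ clusterSpace u J) :
    L⁻¹ * ‖j w‖ ^ 2 ≤ ⟪j w, j (solT j a b Sh Mh (j w))⟫ := by
  obtain ⟨h1, h2⟩ := exists_sum_of_mem_clusterSpace he.orthonormal hJ h
  have h3 : ⟪j w, j (solT j a b Sh Mh (j w))⟫ =
      ∑ i ∈ hJ.toFinset, (lam i)⁻¹ * ⟪j (u i), j w⟫ ^ 2 := by
    nth_rewrite 1 [h1]
    rw [map_sum, sum_inner]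
    refine Finset.sum_congr rfl fun i _ => ?_
    rw [map_smul, real_inner_smul_left, he.inner_solT hw hs]
    ring
  rw [h3, h2, Finset.mul_sum]
  refine Finset.sum_le_sum fun i hi => ?_
  have := hL i (hJ.mem_toFinset.1 hi)
  have := he.pos i
  gcongr

lemma exists_orthogonal (he : IsEigensystem j a b Sh Mh lam sig u) (hJ : J.Finite)
    {I' : Type*} (f : I' → H) (t : Finset I') (hcard : t.card < J.ncard) :
    ∃ w ∈ clusterSpace u J, w ≠ 0 ∧ ∀ k ∈ t, ⟪f k, j w⟫ = 0 := by
  have := hJ.to_subtype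
  let φ : clusterSpace u J →ₗ[ℝ] (t → ℝ) :=
    LinearMap.pi fun k => (innerSL ℝ (f k) ∘L j : M →ₗ[ℝ] ℝ) ∘ₗ (clusterSpace u J).subtype
  have hker : LinearMap.ker φ ≠ ⊥ := by
    apply LinearMap.ker_ne_bot_of_finrank_lt
    rw [finrank_clusterSpace he.orthonormal]
    simpa using hcard
  obtain ⟨w, hw, hw0⟩ := Submodule.exists_mem_ne_zero_of_ne_bot hker
  refine ⟨w, w.2, by simpa using hw0, fun k hk => ?_⟩
  exact congrFun (LinearMap.mem_ker.1 hw) ⟨k, hk⟩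

/-- Weyl's inequality for the eigenvalues of two solution operators. -/
lemma inv_le_inv_add (he : IsEigensystem j a b Sh Mh lam sig u) (hw : WellPosed j a b Sh Mh)
    (hs : IsMixedSetting j a b) (hJ : J.Finite) {L : ℝ} (hL : ∀ i ∈ J, lam i ≤ L)
    {I' : Type*} (f : I' → H) (t : Finset I') (hcard : t.card < J.ncard)
    {T' : H → H} {ε μ : ℝ} (hε : ∀ g, ‖j (solT j a b Sh Mh g) - T' g‖ ≤ ε * ‖g‖)
    (hT' : ∀ x, (∀ k ∈ t, ⟪f k, x⟫ = 0) → ⟪x, T' x⟫ ≤ μ * ‖x‖ ^ 2) : L⁻¹ ≤ μ + ε := by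
  -- By a dimension count, a vector with quotient at least `L⁻¹` for one operator and at most `μ`
  -- for the other.
  obtain ⟨w, hwJ, hw0, hwt⟩ := he.exists_orthogonal hJ f t hcard
  have h1 := he.le_inner_solT hw hs hJ hL hwJ
  have h2 := hT' (j w) hwt
  have hpos : 0 < ‖j w‖ := norm_pos_iff.2 fun h =>
    hw0 (hs.embedding_injective (by simpa using h))
  have h3 : ⟪j w, j (solT j a b Sh Mh (j w)) - T' (j w)⟫ ≤ ε * ‖j w‖ ^ 2 := by
    refine (real_inner_le_norm _ _).trans ?_
    have := mul_le_mul_of_nonneg_left (hε (j w)) hpos.le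
    nlinarith
  rw [inner_sub_right] at h3
  have h4 : L⁻¹ * ‖j w‖ ^ 2 ≤ (μ + ε) * ‖j w‖ ^ 2 := by linarith
  exact le_of_mul_le_mul_right h4 (by positivity)

end IsEigensystem

section Discrete

variable {R : ℝ} {d : ℕ} {lamh : Fin d → ℝ} {sigh : Fin d → S} {uh : Fin d → M}

lemma IsEigensystem.clusterSpace_univ (heh : IsEigensystem j a b Sh Mh lamh sigh uh)
    [FiniteDimensional ℝ Mh] (hdim : d = Module.finrank ℝ Mh) :
    clusterSpace uh Set.univ = Mh := by
  apply Submodule.eq_of_le_of_finrank_eq (clusterSpace_le fun k _ => (heh.eigen k).2.1)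
  rw [finrank_clusterSpace heh.orthonormal, Set.ncard_univ, Nat.card_eq_fintype_card,
    Fintype.card_fin, hdim]

/-- The quadratic form is a finite sum of squares because `T_h x` lies in `Mh`; Bessel's inequality
suffices although `x` may lie outside `Mh`. -/
lemma IsEigensystem.inner_solT_le_of_discrete (heh : IsEigensystem j a b Sh Mh lamh sigh uh)
    [FiniteDimensional ℝ Mh] (hdim : d = Module.finrank ℝ Mh) (hs : IsMixedSetting j a b)
    (hwh : WellPosed j a b Sh Mh) (m : Fin d) {x : H}
    (hx : ∀ k ∈ Finset.Iio m, ⟪j (uh k), x⟫ = 0) :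
    ⟪x, j (solT j a b Sh Mh x)⟫ ≤ (lamh m)⁻¹ * ‖x‖ ^ 2 := by
  have hmem : solT j a b Sh Mh x ∈ clusterSpace uh Set.univ := by
    rw [heh.clusterSpace_univ hdim]
    exact (hwh.source x).2.1
  obtain ⟨h1, -⟩ := exists_sum_of_mem_clusterSpace heh.orthonormal Set.finite_univ hmem
  have h2 : ⟪x, j (solT j a b Sh Mh x)⟫ = ∑ k, (lamh k)⁻¹ * ⟪j (uh k), x⟫ ^ 2 := by
    rw [h1, map_sum, inner_sum]
    simp only [Set.Finite.toFinset_univ]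
    refine Finset.sum_congr rfl fun k _ => ?_
    rw [map_smul, real_inner_smul_right, heh.inner_solT hwh hs, real_inner_comm]
    ring
  have h3 := heh.orthonormal.sum_inner_products_le (s := Finset.univ) (x := x)
  rw [h2]
  calc _ ≤ ∑ k, (lamh m)⁻¹ * ⟪j (uh k), x⟫ ^ 2 := by
        refine Finset.sum_le_sum fun k _ => ?_
        rcases lt_or_ge k m with hkm | hkm
        · rw [hx k (Finset.mem_Iio.2 hkm)]; simp
        · have := heh.mono hkm
          have := heh.pos m
          gcongr
    _ = (lamh m)⁻¹ * ∑ k, ‖⟪j (uh k), x⟫‖ ^ 2 := by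
        rw [Finset.mul_sum]; simp
    _ ≤ _ := by
        have := heh.pos m
        gcongr

end Discrete

section Continuous

variable [CompleteSpace H] {lam : ℕ → ℝ} {sig : ℕ → S} {u : ℕ → M}

/-- Spectral theorem for the compact symmetric `T`: eigenvectors for `μ ≠ 0` solve the eigenvalue
problem with `μ⁻¹`, hence are in the span by `complete`; `μ = 0` is excluded by injectivity. -/
lemma IsEigensystem.orthogonal_span_eq_bot (he : IsEigensystem j a b ⊤ ⊤ lam sig u)
    (hs : IsMixedSetting j a b) (hw : WellPosed j a b ⊤ ⊤)
    (hc : IsCompactOperator (solTH j a b ⊤ ⊤)) :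
    (Submodule.span ℝ (Set.range fun i => j (u i)))ᗮ = ⊥ := by
  have hsymm : (solTH j a b ⊤ ⊤).IsSymmetric := fun f g => by
    change ⟪j (solT j a b ⊤ ⊤ f), g⟫ = ⟪f, j (solT j a b ⊤ ⊤ g)⟫
    rw [real_inner_comm, hw.inner_solT_comm hs]
  let T : H →L[ℝ] H := ContinuousLinearMap.mkOfIsCompactOperator hc
  have h := ContinuousLinearMap.orthogonalComplement_iSup_eigenspaces_eq_bot (T := T) hc hsymm
  rw [eq_bot_iff, ← h]
  apply Submodule.orthogonal_le
  refine iSup_le fun μ x hx => ?_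
  have hx' : j (solT j a b ⊤ ⊤ x) = μ • x := Module.End.mem_eigenspace_iff.1 hx
  rcases eq_or_ne μ 0 with rfl | hμ
  · have h1 : solT j a b ⊤ ⊤ x = 0 := hs.embedding_injective (by simpa using hx')
    rw [hw.solT_injective hs h1]
    exact Submodule.zero_mem _
  · obtain ⟨-, -, h1, h2⟩ := (hw.source x).smul μ⁻¹
    have h3 : j (μ⁻¹ • solT j a b ⊤ ⊤ x) = x := by
      rw [map_smul, hx', smul_smul, inv_mul_cancel₀ hμ, one_smul]
    have h4 := he.complete μ⁻¹ (μ⁻¹ • solA j a b ⊤ ⊤ x) (μ⁻¹ • solT j a b ⊤ ⊤ x)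
      ⟨trivial, trivial, h1, fun v hv => by
        rw [h2 v hv, h3, real_inner_smul_left, neg_mul]⟩
    rw [← h3]
    have h5 := Submodule.mem_map_of_mem (f := (j : M →ₗ[ℝ] H)) h4
    rw [Submodule.map_span] at h5
    refine Submodule.span_mono ?_ h5
    rintro _ ⟨_, ⟨i, -, rfl⟩, rfl⟩
    exact ⟨i, rfl⟩

lemma IsEigensystem.inner_solT_le (he : IsEigensystem j a b ⊤ ⊤ lam sig u)
    (hs : IsMixedSetting j a b) (hw : WellPosed j a b ⊤ ⊤)
    (hc : IsCompactOperator (solTH j a b ⊤ ⊤)) (m : ℕ) {x : H}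
    (hx : ∀ k ∈ Finset.range m, ⟪j (u k), x⟫ = 0) :
    ⟪x, j (solT j a b ⊤ ⊤ x)⟫ ≤ (lam m)⁻¹ * ‖x‖ ^ 2 := by
  let B := HilbertBasis.mkOfOrthogonalEqBot he.orthonormal (he.orthogonal_span_eq_bot hs hw hc)
  have hB : ∀ i, B i = j (u i) := fun i =>
    congrFun (HilbertBasis.coe_mkOfOrthogonalEqBot he.orthonormal
      (he.orthogonal_span_eq_bot hs hw hc)) i
  have h1 := B.hasSum_inner_mul_inner x (j (solT j a b ⊤ ⊤ x))
  have h2 := (B.hasSum_inner_mul_inner x x).mul_left (lam m)⁻¹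
  rw [real_inner_self_eq_norm_sq] at h2
  refine hasSum_le (fun i => ?_) h1 h2
  rw [hB, he.inner_solT hw hs, real_inner_comm]
  rcases lt_or_ge i m with him | him
  · rw [hx i (Finset.mem_range.2 him)]; simp
  · have h3 : (lam i)⁻¹ ≤ (lam m)⁻¹ := inv_anti₀ (he.pos m) (he.mono him)
    nlinarith [mul_le_mul_of_nonneg_right h3 (sq_nonneg ⟪j (u i), x⟫)]

lemma IsEigensystem.abs_inv_sub_inv_le {d : ℕ} {lamh : Fin d → ℝ} {sigh : Fin d → S}
    {uh : Fin d → M} (he : IsEigensystem j a b ⊤ ⊤ lam sig u)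
    (heh : IsEigensystem j a b Sh Mh lamh sigh uh)
    [FiniteDimensional ℝ Mh] (hdim : d = Module.finrank ℝ Mh)
    (hs : IsMixedSetting j a b) (hw : WellPosed j a b ⊤ ⊤) (hwh : WellPosed j a b Sh Mh)
    (hc : IsCompactOperator (solTH j a b ⊤ ⊤)) {ε : ℝ}
    (hε : ∀ g, ‖j (solT j a b ⊤ ⊤ g) - j (solT j a b Sh Mh g)‖ ≤ ε * ‖g‖) (k : Fin d) :
    |(lamh k)⁻¹ - (lam k)⁻¹| ≤ ε := by
  have h1 : (lam k)⁻¹ ≤ (lamh k)⁻¹ + ε := by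
    refine he.inv_le_inv_add hw hs (J := Set.Iic (k : ℕ)) (Set.finite_Iic _)
      (fun i hi => he.mono hi) (fun i => j (uh i)) (Finset.Iio k) ?_ hε
      (fun x hx => heh.inner_solT_le_of_discrete hdim hs hwh k hx)
    rw [Fin.card_Iio, Set.ncard_eq_toFinset_card']
    simp
  have h2 : (lamh k)⁻¹ ≤ (lam k)⁻¹ + ε := by
    refine heh.inv_le_inv_add hwh hs (J := Set.Iic k) (Set.finite_Iic _)
      (fun i hi => heh.mono hi) (fun i => j (u i)) (Finset.range k) ?_
      (T' := fun g => j (solT j a b ⊤ ⊤ g)) (fun g => by rw [norm_sub_rev]; exact hε g)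
      (fun x hx => he.inner_solT_le hs hw hc k hx)
    rw [Finset.card_range, Set.ncard_eq_toFinset_card']
    simp
  rw [abs_le]
  constructor <;> linarith

end Continuous

/-! ### Closeness of separated clusters -/

section Separated

variable {lam : ℕ → ℝ} {sig : ℕ → S} {u : ℕ → M}
  {d : ℕ} {lamh : Fin d → ℝ} {sigh : Fin d → S} {uh : Fin d → M}

/-- The residual `y` of `u i` in the discrete eigenvalue equation is at most `ε`. Outside the
cluster each discrete component of `u i` enters `y` with a factor of modulus at least `s`, and so
does its part orthogonal to `Mh`. -/
lemma IsEigensystem.norm_sub_proj_eigenfunction_le (he : IsEigensystem j a b ⊤ ⊤ lam sig u)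
    (heh : IsEigensystem j a b Sh Mh lamh sigh uh)
    [FiniteDimensional ℝ Mh] (hdim : d = Module.finrank ℝ Mh)
    (hs : IsMixedSetting j a b) (hw : WellPosed j a b ⊤ ⊤) (hwh : WellPosed j a b Sh Mh) {ε s : ℝ}
    (hε : ∀ g, ‖j (solT j a b ⊤ ⊤ g) - j (solT j a b Sh Mh g)‖ ≤ ε * ‖g‖) {Jh : Set (Fin d)}
    {F : M → M} (hF : ∀ x, F x ∈ clusterSpace uh Jh)
    (hFo : ∀ x, ∀ w ∈ clusterSpace uh Jh, ⟪j x, j w⟫ = ⟪j (F x), j w⟫) {i : ℕ} (hs0 : 0 < s)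
    (hsi : s ≤ (lam i)⁻¹) (hsk : ∀ k ∉ Jh, s ≤ |(lamh k)⁻¹ - (lam i)⁻¹|) :
    ‖j (u i) - j (F (u i))‖ ≤ ε / s := by
  classical
  obtain ⟨P, hP, hPo, -⟩ := exists_projF_eq j Mh
  have hJhf : Jh.Finite := Set.toFinite _
  have hli : 0 < (lam i)⁻¹ := hs0.trans_le hsi
  have hPuniv : ∀ z, P z ∈ clusterSpace uh Set.univ := fun z => by
    rw [heh.clusterSpace_univ hdim]; exact hP z
  have hsplit : ∀ z, ‖j z‖ ^ 2 = ‖j z - j (P z)‖ ^ 2 + ∑ k, ⟪j (uh k), j z⟫ ^ 2 := fun z => by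
    have h1 := norm_sub_sq_of_inner_eq hP hPo z (Submodule.zero_mem _)
    have h2 := (exists_sum_of_mem_clusterSpace heh.orthonormal Set.finite_univ (hPuniv z)).2
    simp only [map_zero, sub_zero] at h1
    rw [h1, h2]
    simp only [Set.Finite.toFinset_univ]
    congr 1
    refine Finset.sum_congr rfl fun k _ => ?_
    rw [real_inner_comm, ← hPo z _ (heh.eigen k).2.1, real_inner_comm]
  have hsplitF : ∀ z, ‖j z‖ ^ 2 =
      ‖j z - j (F z)‖ ^ 2 + ∑ k ∈ hJhf.toFinset, ⟪j (uh k), j z⟫ ^ 2 := fun z => by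
    have h1 := norm_sub_sq_of_inner_eq hF hFo z (Submodule.zero_mem _)
    have h2 := (exists_sum_of_mem_clusterSpace heh.orthonormal hJhf (hF z)).2
    simp only [map_zero, sub_zero] at h1
    rw [h1, h2]
    congr 1
    refine Finset.sum_congr rfl fun k hk => ?_
    rw [real_inner_comm, ← hFo z _ (mem_clusterSpace uh (hJhf.mem_toFinset.1 hk)),
      real_inner_comm]
  set y : M := solT j a b Sh Mh (j (u i)) - (lam i)⁻¹ • u i with hy
  have hynorm : ‖j y‖ ≤ ε := by
    have h1 := hε (j (u i))
    rw [he.orthonormal.norm_eq_one i, he.solT_apply hw, norm_sub_rev, ← map_sub] at h1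
    simpa [hy] using h1
  have hcoef : ∀ k, ⟪j (uh k), j y⟫ = ((lamh k)⁻¹ - (lam i)⁻¹) * ⟪j (uh k), j (u i)⟫ := fun k => by
    rw [hy, map_sub, inner_sub_right, heh.inner_solT hwh hs, map_smul, real_inner_smul_right]
    ring
  -- As `T_h (u i)` lies in `Mh`, the part of `y` orthogonal to `Mh` comes from `-(lam i)⁻¹ • u i`
  -- alone.
  have hperp : (lam i)⁻¹ * ‖j (u i) - j (P (u i))‖ ≤ ‖j y - j (P y)‖ := by
    have h1 := (norm_sub_le_of_inner_eq hP hPo (u i) (v := lam i • (solT j a b Sh Mh (j (u i)) - P y))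
      (Mh.smul_mem _ (Mh.sub_mem (hwh.source _).2.1 (hP _)))).1
    have hne := (he.pos i).ne'
    have h2 : j (u i) - j (lam i • (solT j a b Sh Mh (j (u i)) - P y)) =
        (-lam i) • (j y - j (P y)) := by
      have h3 : j (solT j a b Sh Mh (j (u i))) = j y + (lam i)⁻¹ • j (u i) := by
        rw [hy, map_sub, map_smul]; abel
      rw [map_smul, map_sub, h3]
      simp only [smul_sub, smul_add, smul_smul, mul_inv_cancel₀ hne, one_smul, neg_smul]
      abel
    rw [h2, norm_smul, norm_neg, Real.norm_eq_abs, abs_of_pos (he.pos i)] at h1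
    rw [inv_mul_eq_div, div_le_iff₀' (he.pos i)]
    exact h1
  have hmain : s ^ 2 * ‖j (u i) - j (F (u i))‖ ^ 2 ≤ ε ^ 2 := by
    have h1 := hsplit (u i)
    have h2 := hsplitF (u i)
    have h3 := hsplit y
    have h4 : ∑ k, ⟪j (uh k), j (u i)⟫ ^ 2 = ∑ k ∈ hJhf.toFinset, ⟪j (uh k), j (u i)⟫ ^ 2 +
        ∑ k ∈ hJhf.toFinsetᶜ, ⟪j (uh k), j (u i)⟫ ^ 2 :=
      (Finset.sum_add_sum_compl _ _).symm
    have h5 : s ^ 2 * ∑ k ∈ hJhf.toFinsetᶜ, ⟪j (uh k), j (u i)⟫ ^ 2 ≤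
        ∑ k, ⟪j (uh k), j y⟫ ^ 2 := by
      rw [Finset.mul_sum]
      refine le_trans (Finset.sum_le_sum fun k hk => ?_)
        (Finset.sum_le_univ_sum_of_nonneg (s := hJhf.toFinsetᶜ) fun k => sq_nonneg _)
      rw [hcoef, mul_pow]
      have h6 : s ≤ |(lamh k)⁻¹ - (lam i)⁻¹| := hsk k (by simpa using hk)
      rw [← sq_abs ((lamh k)⁻¹ - (lam i)⁻¹)]
      gcongr
    have h6 : s ^ 2 * ‖j (u i) - j (P (u i))‖ ^ 2 ≤ ‖j y - j (P y)‖ ^ 2 := by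
      rw [← mul_pow]
      exact pow_le_pow_left₀ (by positivity) (le_trans (by gcongr) hperp) 2
    have h7 : ‖j y‖ ^ 2 ≤ ε ^ 2 := by gcongr
    have h8 : ‖j (u i) - j (F (u i))‖ ^ 2 = ‖j (u i) - j (P (u i))‖ ^ 2 +
        ∑ k ∈ hJhf.toFinsetᶜ, ⟪j (uh k), j (u i)⟫ ^ 2 := by linarith
    rw [h8, mul_add]
    linarith
  rw [le_div_iff₀' hs0]
  refine le_of_sq_le_sq ?_ ((norm_nonneg _).trans hynorm)
  rwa [mul_pow]

lemma norm_sub_proj_le_of_eigenfunctions {I : Type*} {u : I → M} {J : Set I} {Wh : Submodule ℝ M}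
    (ho : Orthonormal ℝ fun i => j (u i)) (hJ : J.Finite) {F : M → M} (hF : ∀ x, F x ∈ Wh)
    (hFo : ∀ x, ∀ w ∈ Wh, ⟪j x, j w⟫ = ⟪j (F x), j w⟫) {η : ℝ}
    (h : ∀ i ∈ J, ‖j (u i) - j (F (u i))‖ ≤ η) {x : M} (hx : x ∈ clusterSpace u J) :
    ‖j x - j (F x)‖ ≤ J.ncard * η * ‖j x‖ := by
  obtain ⟨h1, -⟩ := exists_sum_of_mem_clusterSpace ho hJ hx
  set v : M := ∑ i ∈ hJ.toFinset, ⟪j (u i), j x⟫ • F (u i) with hv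
  have hvW : v ∈ Wh := Submodule.sum_mem _ fun i _ => Submodule.smul_mem _ _ (hF _)
  refine (norm_sub_le_of_inner_eq hF hFo x hvW).1.trans ?_
  have h2 : j x - j v = ∑ i ∈ hJ.toFinset, ⟪j (u i), j x⟫ • (j (u i) - j (F (u i))) := by
    conv_lhs => rw [h1]
    rw [hv, map_sum, map_sum, ← Finset.sum_sub_distrib]
    refine Finset.sum_congr rfl fun i _ => ?_
    rw [map_smul, map_smul, smul_sub]
  rw [h2]
  refine (norm_sum_le _ _).trans ?_
  calc _ ≤ ∑ i ∈ hJ.toFinset, ‖j x‖ * η := by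
        refine Finset.sum_le_sum fun i hi => ?_
        rw [norm_smul]
        have h3 := h i (hJ.mem_toFinset.1 hi)
        have h4 := norm_inner_le_norm (𝕜 := ℝ) (j (u i)) (j x)
        rw [ho.norm_eq_one i, one_mul] at h4
        gcongr
    _ = _ := by
        rw [Finset.sum_const, Set.ncard_eq_toFinset_card J hJ, nsmul_eq_mul]; ring

end Separated

lemma exists_pos_le_of_finset {ι : Type*} (t : Finset ι) {f : ι → ℝ} (hf : ∀ i ∈ t, 0 < f i) :
    ∃ s : ℝ, 0 < s ∧ ∀ i ∈ t, s ≤ f i := by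
  rcases t.eq_empty_or_nonempty with rfl | ht
  · exact ⟨1, one_pos, by simp⟩
  · obtain ⟨i, hi, h⟩ := t.exists_min_image f ht
    exact ⟨f i, hf i hi, h⟩

/-- The reciprocal eigenvalues of a separated cluster keep a positive distance from zero and from
all the other reciprocal eigenvalues. -/
lemma exists_separation {lam : ℕ → ℝ} (hpos : ∀ i, 0 < lam i) (hmono : Monotone lam) {n N : ℕ}
    (hsep : ∀ i ∈ Set.Ico n (n + N), ∀ k ∉ Set.Ico n (n + N), lam i ≠ lam k) :
    ∃ s : ℝ, 0 < s ∧ ∀ i ∈ Set.Ico n (n + N), s ≤ (lam i)⁻¹ ∧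
      ∀ k ∉ Set.Ico n (n + N), 2 * s ≤ |(lam k)⁻¹ - (lam i)⁻¹| := by
  classical
  obtain ⟨s₁, hs₁, h₁⟩ := exists_pos_le_of_finset (Finset.Ico n (n + N)) (f := fun i => (lam i)⁻¹)
    fun i _ => inv_pos.2 (hpos i)
  obtain ⟨s₂, hs₂, h₂⟩ := exists_pos_le_of_finset
    (Finset.Ico n (n + N) ×ˢ (Finset.range (n + N + 1) \ Finset.Ico n (n + N)))
    (f := fun p => |(lam p.2)⁻¹ - (lam p.1)⁻¹|) (by
      rintro ⟨i, k⟩ hp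
      simp only [Finset.mem_product, Finset.mem_sdiff] at hp
      rw [abs_pos, sub_ne_zero]
      intro h
      refine hsep i (by simpa using hp.1) k (by simpa using hp.2.2) (inv_injective h).symm)
  -- The distance is `2 * s` so that `s` is left after the discrete reciprocals move by at most `s`.
  refine ⟨min s₁ (s₂ / 2), by positivity, fun i hi =>
    ⟨(min_le_left _ _).trans (h₁ i (by simpa using hi)), fun k hk => ?_⟩⟩
  have hle : 2 * min s₁ (s₂ / 2) ≤ s₂ := by linarith [min_le_right s₁ (s₂ / 2)]
  refine hle.trans ?_
  -- Monotonicity reduces all `k` beyond `n + N` to `k = n + N`, so finitely many distances matter.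
  rcases le_or_gt k (n + N) with hkN | hkN
  · exact h₂ (i, k) (by
      simp only [Finset.mem_product, Finset.mem_sdiff, Finset.mem_range]
      exact ⟨by simpa using hi, by omega, by simpa using hk⟩)
  · have h3 := h₂ (i, n + N) (by
      simp only [Finset.mem_product, Finset.mem_sdiff, Finset.mem_range]
      exact ⟨by simpa using hi, by omega, by simp⟩)
    have h4 : (lam (n + N))⁻¹ ≤ (lam i)⁻¹ := inv_anti₀ (hpos i) (hmono hi.2.le)
    have h5 : (lam k)⁻¹ ≤ (lam (n + N))⁻¹ := inv_anti₀ (hpos _) (hmono hkN.le)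
    simp only at h3
    rw [abs_of_nonpos (by linarith)] at h3 ⊢
    linarith

/-- For a separated cluster the gap becomes small as the approximation constant does. -/
theorem exists_gap_le [CompleteSpace H] (hs : IsMixedSetting j a b) (hw : WellPosed j a b ⊤ ⊤)
    (hc : IsCompactOperator (solTH j a b ⊤ ⊤))
    {K : ℝ} (hK0 : 0 ≤ K) (hK : ∀ g : H, normA a (solA j a b ⊤ ⊤ g) ≤ K * ‖g‖)
    {lam : ℕ → ℝ} {sig : ℕ → S} {u : ℕ → M} (he : IsEigensystem j a b ⊤ ⊤ lam sig u)
    {n N : ℕ} (hsep : ∀ i ∈ Set.Ico n (n + N), ∀ k ∉ Set.Ico n (n + N), lam i ≠ lam k)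
    {θ : ℝ} (hθ : 0 < θ) :
    ∃ ρ : ℝ, 0 < ρ ∧ ∀ (Sh : Submodule ℝ S) (Mh : Submodule ℝ M)
        (lamh : Fin (Module.finrank ℝ Mh) → ℝ) (sigh : Fin (Module.finrank ℝ Mh) → S)
        (uh : Fin (Module.finrank ℝ Mh) → M),
        IsDiscretization j a b Sh Mh ρ →
        IsEigensystem j a b Sh Mh lamh sigh uh →
        gap j a b Sh (clusterSpace u (Set.Ico n (n + N)))
          (clusterSpace uh {k | (k : ℕ) ∈ Set.Ico n (n + N)}) ≤ θ := by
  obtain ⟨s, hs0, hsJ⟩ := exists_separation he.pos he.mono hsep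
  set J : Set ℕ := Set.Ico n (n + N) with hJ
  have hJf : J.Finite := Set.finite_Ico _ _
  set Λ := lam (n + N) with hΛdef
  have hΛ0 : 0 < Λ := he.pos _
  have hlam : ∀ i ∈ J, lam i ≤ Λ := fun i hi => he.mono hi.2.le
  set E := 1 + (K + 1) with hE
  have hE0 : 0 < E := by positivity
  set Q := (E + 1 + ((K + 1) ^ 2 + (K + 1)) * (J.ncard * (E / s))) * Λ with hQ
  have hQ0 : 0 < Q := by positivity
  -- The three entries bound `K + ρ` by `K + 1`, the shift of the reciprocals by `s`, and the gap by
  -- `θ`.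
  set ρ := min 1 (min (s / E) (θ / Q)) with hρ
  have hρ0 : 0 < ρ := by positivity
  have hρ1 : ρ ≤ 1 := min_le_left _ _
  have hρs : ρ * E ≤ s := by
    rw [← le_div_iff₀ hE0]
    exact (min_le_right _ _).trans (min_le_left _ _)
  have hρθ : ρ * Q ≤ θ := by
    rw [← le_div_iff₀ hQ0]
    exact (min_le_right _ _).trans (min_le_right _ _)
  refine ⟨ρ, hρ0, fun Sh Mh lamh sigh uh hd heh => ?_⟩
  have hwh := hd.wellPosed hs
  have := hd.finite_M
  set Jh : Set (Fin (Module.finrank ℝ Mh)) := {k | (k : ℕ) ∈ J} with hJh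
  have hKh : ∀ g, normA a (solA j a b Sh Mh g) ≤ (K + 1) * ‖g‖ := fun g =>
    (hd.normA_solA_le hs hw hwh hK g).trans (by gcongr)
  have hTh := hwh.norm_solT_le hs hKh
  have hε : ∀ g, ‖j (solT j a b ⊤ ⊤ g) - j (solT j a b Sh Mh g)‖ ≤ ρ * E * ‖g‖ := fun g =>
    (hd.norm_solT_sub_le hs hw hwh (by positivity) hK g).trans (by rw [hE]; gcongr)
  have hev := he.abs_inv_sub_inv_le heh rfl hs hw hwh hc hε
  obtain ⟨F, hF, hFo, -⟩ := exists_projF_eq j (clusterSpace uh Jh)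
  have hη : ∀ i ∈ J, ‖j (u i) - j (F (u i))‖ ≤ ρ * E / s := fun i hi =>
    he.norm_sub_proj_eigenfunction_le heh rfl hs hw hwh hε hF hFo hs0 (hsJ i hi).1 fun k hk => by
      have h1 := (hsJ i hi).2 k hk
      have h2 := (hev k).trans hρs
      have h3 := abs_sub_abs_le_abs_sub ((lam k)⁻¹ - (lam i)⁻¹) ((lam k)⁻¹ - (lamh k)⁻¹)
      rw [sub_sub_sub_cancel_left, abs_sub_comm (lam k)⁻¹ (lamh k)⁻¹] at h3
      linarith
  refine gap_le hθ.le fun x hx hx1 => ?_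
  obtain ⟨g, hg, rfl, hgle⟩ := he.exists_solT_eq hw hJf hlam hΛ0.le hx
  rw [hx1, mul_one] at hgle
  -- For `x = T g` the competitor is `T_h F g`: its flux is `A_h F g`, so both parts of the distance
  -- follow from convergence of the solution operators and from `g - F g`.
  refine ⟨solT j a b Sh Mh (j (F g)), heh.solT_mem hwh (hF g), (mixedDist_le_add _ _).trans ?_⟩
  have hgF := norm_sub_proj_le_of_eigenfunctions he.orthonormal hJf hF hFo hη hg
  have h1 : ‖j (solT j a b ⊤ ⊤ (j g)) - j (solT j a b Sh Mh (j (F g)))‖ ≤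
      ρ * E * ‖j g‖ + (K + 1) ^ 2 * (J.ncard * (ρ * E / s) * ‖j g‖) := by
    refine (norm_sub_le_norm_sub_add_norm_sub _ (j (solT j a b Sh Mh (j g))) _).trans ?_
    refine add_le_add (hε _) ?_
    rw [← map_sub j, ← map_sub (solT j a b Sh Mh)]
    exact (hTh _).trans (by gcongr)
  have h2 : normA a (G a b ⊤ (solT j a b ⊤ ⊤ (j g)) - G a b Sh (solT j a b Sh Mh (j (F g)))) ≤
      ρ * ‖j g‖ + (K + 1) * (J.ncard * (ρ * E / s) * ‖j g‖) := by
    rw [hw.G_solT hs, hwh.G_solT hs]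
    refine (hs.normA_sub_le _ (solA j a b Sh Mh (j g)) _).trans ?_
    refine add_le_add (hd.normA_solA_sub_le hs hw hwh _) ?_
    rw [← map_sub (solA j a b Sh Mh)]
    exact (hKh _).trans (by gcongr)
  calc _ ≤ ρ * (E + 1 + ((K + 1) ^ 2 + (K + 1)) * (J.ncard * (E / s))) * ‖j g‖ :=
        (add_le_add h1 h2).trans (le_of_eq (by ring))
    _ ≤ ρ * (E + 1 + ((K + 1) ^ 2 + (K + 1)) * (J.ncard * (E / s))) * Λ := by gcongr
    _ = ρ * Q := by rw [hQ]; ring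
    _ ≤ θ := hρθ

end MixedEVP

end

/-! ### Assembly of the two estimates -/

theorem mainTheorem3 {S M H : Type*}
    [NormedAddCommGroup S] [InnerProductSpace ℝ S] [CompleteSpace S]
    [NormedAddCommGroup M] [InnerProductSpace ℝ M] [CompleteSpace M]
    [NormedAddCommGroup H] [InnerProductSpace ℝ H] [CompleteSpace H]
    (j : M →L[ℝ] H) (a : S →L[ℝ] S →L[ℝ] ℝ) (b : S →L[ℝ] M →L[ℝ] ℝ)
    (hset : MixedEVP.IsMixedSetting j a b)
    (hcompact : IsCompactOperator (MixedEVP.solTH j a b ⊤ ⊤))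
    (lam : ℕ → ℝ) (sig : ℕ → S) (u : ℕ → M)
    (heig : MixedEVP.IsEigensystem j a b ⊤ ⊤ lam sig u)
    (n N : ℕ) :
    MixedEVP.WellPosed j a b ⊤ ⊤ ∧
    -- every discretization with `ρ ≤ R` and gap at most `θ < 1`
    (∀ R θ : ℝ, θ < 1 → ∃ C : ℝ,
      ∀ (Sh : Submodule ℝ S) (Mh : Submodule ℝ M)
        (lamh : Fin (Module.finrank ℝ Mh) → ℝ) (sigh : Fin (Module.finrank ℝ Mh) → S)
        (uh : Fin (Module.finrank ℝ Mh) → M),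
        MixedEVP.IsDiscretization j a b Sh Mh R →
        MixedEVP.IsEigensystem j a b Sh Mh lamh sigh uh →
        MixedEVP.gap j a b Sh (MixedEVP.clusterSpace u (Set.Ico n (n + N)))
          (MixedEVP.clusterSpace uh {k | (k : ℕ) ∈ Set.Ico n (n + N)}) ≤ θ →
        MixedEVP.WellPosed j a b Sh Mh ∧
        MixedEVP.HatEstimate (MixedEVP.solTH j a b ⊤ ⊤) (MixedEVP.solTH j a b Sh Mh)
          (MixedEVP.inH j (MixedEVP.clusterSpace u (Set.Ico n (n + N))))
          (MixedEVP.inH j (MixedEVP.clusterSpace uh {k | (k : ℕ) ∈ Set.Ico n (n + N)}))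
          (C * MixedEVP.gap j a b Sh (MixedEVP.clusterSpace u (Set.Ico n (n + N)))
            (MixedEVP.clusterSpace uh {k | (k : ℕ) ∈ Set.Ico n (n + N)}) ^ 2)) ∧
    -- every sufficiently fine discretization, if the cluster is separated from the other eigenvalues
    ((∀ i ∈ Set.Ico n (n + N), ∀ k ∉ Set.Ico n (n + N), lam i ≠ lam k) →
      ∃ ρ₀ : ℝ, 0 < ρ₀ ∧ ∃ C : ℝ,
      ∀ (Sh : Submodule ℝ S) (Mh : Submodule ℝ M)
        (lamh : Fin (Module.finrank ℝ Mh) → ℝ) (sigh : Fin (Module.finrank ℝ Mh) → S)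
        (uh : Fin (Module.finrank ℝ Mh) → M),
        MixedEVP.IsDiscretization j a b Sh Mh ρ₀ →
        MixedEVP.IsEigensystem j a b Sh Mh lamh sigh uh →
        MixedEVP.WellPosed j a b Sh Mh ∧
        MixedEVP.HatEstimate (MixedEVP.solTH j a b ⊤ ⊤) (MixedEVP.solTH j a b Sh Mh)
          (MixedEVP.inH j (MixedEVP.clusterSpace u (Set.Ico n (n + N))))
          (MixedEVP.inH j (MixedEVP.clusterSpace uh {k | (k : ℕ) ∈ Set.Ico n (n + N)}))
          (C * MixedEVP.gap j a b Sh (MixedEVP.clusterSpace u (Set.Ico n (n + N)))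
            (MixedEVP.clusterSpace uh {k | (k : ℕ) ∈ Set.Ico n (n + N)}) ^ 2)) := by
  have hw := hset.wellPosed
  obtain ⟨K, hK0, hK⟩ := MixedEVP.exists_normA_solA_le hw hset hcompact
  refine ⟨hw, fun R θ hθ => ?_, fun hsep => ?_⟩
  -- `R` and `θ` may be negative; enlarging them to be nonnegative only weakens the assumptions.
  · obtain ⟨C, hC⟩ := MixedEVP.exists_hatEstimate hset hw hK0 hK heig n N (le_max_right R 0)
      (le_max_right θ 0) (max_lt hθ one_pos)
    exact ⟨C, fun Sh Mh lamh sigh uh hd heh hgap => ⟨hd.wellPosed hset,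
      hC Sh Mh lamh sigh uh (hd.mono (le_max_left _ _)) heh (hgap.trans (le_max_left _ _))⟩⟩
  · obtain ⟨ρ, hρ, hgap⟩ := MixedEVP.exists_gap_le hset hw hcompact hK0 hK heig hsep
      (one_half_pos (α := ℝ))
    obtain ⟨C, hC⟩ := MixedEVP.exists_hatEstimate hset hw hK0 hK heig n N hρ.le
      (one_half_pos (α := ℝ)).le one_half_lt_one
    exact ⟨ρ, hρ, C, fun Sh Mh lamh sigh uh hd heh => ⟨hd.wellPosed hset,
      hC Sh Mh lamh sigh uh hd heh (hgap Sh Mh lamh sigh uh hd heh)⟩⟩
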